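/- Let $q=2$, let $\mathbb C_\infty$ be the completion of an algebraic closure of $\mathbb F_2((1/\theta))$ (absolute value with $|\theta|>1$), and for a power series $z=\sum_i z_iT^i$ over $\mathbb C_\infty$ put $\tau(z)=\sum_i z_i^2T^i$. Let $\mathbb C_\infty\{T\}$ be the ring of power series $\sum_i z_iT^i\in\mathbb C_\infty[[T]]$ with $z_i\to0$, and let $\mathbb C_\infty\{\tau\}$ be the ring of skew polynomials with $\tau a=a^2\tau$ for $a\in\mathbb C_\infty$. Let $$A=\begin{pmatrix}\theta&\theta^6\\ \theta^{-2}&0\end{pmatrix},$$ and let $M=M(A)$ be the t-motive that is the free left $\mathbb C_\infty\{\tau\}$-module with basis $e=(e_1,e_2)^t$, on which $T$ acts $\mathbb C_\infty\{\tau\}$-linearly by $$Te=\theta e+A\,\tau e+\tau^2e .$$ Let $H^1(M)$ be the $\mathbb F_2[T]$-module of the elements of $M\otimes_{\mathbb C_\infty[T]}\mathbb C_\infty\{T\}$ that are fixed by $\tau\otimes\tau$, let $H_1(M)$ be the $\mathbb F_2[T]$-module of the $\mathbb C_\infty[T]$-linear maps $M\to\mathbb C_\infty\{T\}$ that commute with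 $\tau$, and let $h^1(M)$, $h_1(M)$ be their ranks over $\mathbb F_2[T]$. Then $h^1(M)=0$; that is, $M\otimes_{\mathbb C_\infty[T]}\mathbb C_\infty\{T\}$ has no nonzero $\tau$-invariant element. Moreover $H_1(M)$ is a free $\mathbb F_2[T]$-module and $h_1(M)=1$. In particular $h_1(M)\ne h^1(M)$. -/

import Mathlib

noncomputable section

open Polynomial TensorProduct

namespace AndersonMotive

section Fields

variable (F : Type*) [Field F]

open Classical in
/-- The field `F((1/θ))`: the completion of `F(θ)` for the place at infinity (`ord θ = -1`). -/
abbrev KInf : Type _ := RatFunc.CompletionAtInfty F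

open Classical in
/-- The indeterminate `θ`, as an element of `F((1/θ))`. -/
def KInf.theta : KInf F := algebraMap (RatFunc F) (KInf F) RatFunc.X

open Classical in
lemma KInf.valued_theta : Valued.v (KInf.theta F) = WithZero.exp (1 : ℤ) :=
  ((RatFunc.inftyValued F).extensionValuation_apply_coe RatFunc.X).trans
    (RatFunc.inftyValuation.X F)

variable [Fintype F]

open Classical in
/-- The absolute value on `F((1/θ))` is `|x| = q ^ (-ord x)`, where `q = #F`. -/
instance KInf.rankOne : (Valued.v (R := KInf F) (Γ₀ := WithZero (Multiplicative ℤ))).RankOne where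
  hom' := (WithZeroMulInt.toNNReal (e := (Fintype.card F : NNReal))
      (Nat.cast_ne_zero.2 Fintype.card_ne_zero)).comp MonoidWithZeroHom.ValueGroup₀.embedding
  strictMono' := (WithZeroMulInt.toNNReal_strictMono
      (Nat.one_lt_cast.2 Fintype.one_lt_card)).comp
      MonoidWithZeroHom.ValueGroup₀.embedding_strictMono
  exists_val_nontrivial := ⟨KInf.theta F, by rw [KInf.valued_theta]; simp⟩

open Classical in
instance KInf.nontriviallyNormedField : NontriviallyNormedField (KInf F) :=
  Valued.toNontriviallyNormedField (KInf F) (WithZero (Multiplicative ℤ))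

open Classical in
instance KInf.isUltrametricDist : IsUltrametricDist (KInf F) :=
  inferInstanceAs (@IsUltrametricDist (KInf F)
    (Valued.toNormedField (KInf F) (WithZero (Multiplicative ℤ))).toDist)

open Classical in
instance KInf.completeSpace : CompleteSpace (KInf F) :=
  inferInstanceAs (@CompleteSpace (@UniformSpace.Completion (RatFunc F)
    (RatFunc.inftyValued F).toUniformSpace) _)

/-- The algebraic closure of `F((1/θ))`. -/
abbrev KInfAlg : Type _ := AlgebraicClosure (KInf F)

/-- The unique extension of the absolute value of `F((1/θ))` to its algebraic closure. -/
instance KInfAlg.nontriviallyNormedField : NontriviallyNormedField (KInfAlg F) :=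
  spectralNorm.nontriviallyNormedField (KInf F) (KInfAlg F)

instance KInfAlg.isUltrametricDist : IsUltrametricDist (KInfAlg F) :=
  IsUltrametricDist.isUltrametricDist_of_forall_norm_add_le_max_norm
    (isNonarchimedean_spectralNorm (K := KInf F) (L := KInfAlg F))

/-- The field `C∞`: the completion of the algebraic closure of `F((1/θ))`. -/
def CInf : Type _ := UniformSpace.Completion (KInfAlg F)

instance CInf.normedField : NormedField (CInf F) :=
  inferInstanceAs (NormedField (UniformSpace.Completion (KInfAlg F)))

instance CInf.completeSpace : CompleteSpace (CInf F) :=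
  inferInstanceAs (CompleteSpace (UniformSpace.Completion (KInfAlg F)))

/-- The inclusion of the algebraic closure of `F((1/θ))` in `C∞`. -/
def CInf.ofAlg : KInfAlg F →+* CInf F := UniformSpace.Completion.coeRingHom (α := KInfAlg F)

instance CInf.isUltrametricDist : IsUltrametricDist (CInf F) := by
  refine IsUltrametricDist.isUltrametricDist_of_forall_norm_add_le_max_norm fun x y ↦ ?_
  refine UniformSpace.Completion.induction_on₂ (α := KInfAlg F) (β := KInfAlg F) x y ?_ ?_
  · exact isClosed_le (continuous_add (M := CInf F)).norm
      ((continuous_norm (E := CInf F)).fst'.max (continuous_norm (E := CInf F)).snd')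
  · intro a b
    have h (c : KInfAlg F) : ‖CInf.ofAlg F c‖ = ‖c‖ := UniformSpace.Completion.norm_coe c
    change ‖CInf.ofAlg F a + CInf.ofAlg F b‖ ≤ max ‖CInf.ofAlg F a‖ ‖CInf.ofAlg F b‖
    rw [← map_add, h, h, h]
    exact IsUltrametricDist.norm_add_le_max a b

/-- The element `θ` of `C∞`. -/
def CInf.theta : CInf F := CInf.ofAlg F (algebraMap (KInf F) (KInfAlg F) (KInf.theta F))

open Classical in
/-- `C∞` as an extension of the field of constants `F`. -/
instance CInf.algebra : Algebra F (CInf F) :=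
  ((CInf.ofAlg F).comp ((algebraMap (KInf F) (KInfAlg F)).comp
    ((algebraMap (RatFunc F) (KInf F)).comp RatFunc.C))).toAlgebra

/-- The `q`-Frobenius `a ↦ a ^ q` of `C∞`, where `q = #F`. -/
def frob : CInf F →+* CInf F := (FiniteField.frobeniusAlgHom F (CInf F)).toRingHom

lemma frob_apply (a : CInf F) : frob F a = a ^ Fintype.card F := rfl

end Fields

section Rings

variable (F : Type*) [Field F] [Fintype F]

/-- The action of `τ` on `C∞[T]`: the `q`-Frobenius on the coefficients. -/
def polyFrob : (CInf F)[X] →+* (CInf F)[X] := Polynomial.mapRingHom (frob F)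

/-- `F[T]` acts on `C∞[T]`-modules through the inclusion `F[T] ⊆ C∞[T]`. -/
instance polyAlgebra : Algebra F[X] (CInf F)[X] :=
  (Polynomial.mapRingHom (algebraMap F (CInf F))).toAlgebra

lemma isRestricted_one_iff (f : PowerSeries (CInf F)) : PowerSeries.IsRestricted 1 f ↔
    Filter.Tendsto (fun i ↦ PowerSeries.coeff i f) Filter.atTop (nhds 0) := by
  rw [PowerSeries.isRestricted_iff']
  simp only [one_pow, mul_one]
  exact tendsto_zero_iff_norm_tendsto_zero.symm

/-- The ring `C∞{T}` of the power series `∑ aᵢ Tⁱ` with `aᵢ → 0`, as a `C∞[T]`-subalgebra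
of `C∞[[T]]`. -/
def Tate : Subalgebra (CInf F)[X] (PowerSeries (CInf F)) where
  carrier := {f | Filter.Tendsto (fun i ↦ PowerSeries.coeff i f) Filter.atTop (nhds 0)}
  add_mem' {f g} hf hg := by
    simpa using Filter.Tendsto.add hf hg
  mul_mem' {f g} hf hg := (isRestricted_one_iff F _).1
    (PowerSeries.isRestricted.mul 1 ((isRestricted_one_iff F f).2 hf)
      ((isRestricted_one_iff F g).2 hg))
  algebraMap_mem' p := by
    refine tendsto_const_nhds.congr' ?_
    filter_upwards [Filter.eventually_gt_atTop p.natDegree] with i hi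
    simp [PowerSeries.algebraMap_apply', Polynomial.coeff_eq_zero_of_natDegree_lt hi]

/-- The action of `τ` on `C∞{T}`: the `q`-Frobenius on the coefficients. -/
def tateFrob : Tate F →ₛₗ[polyFrob F] Tate F where
  toFun f := ⟨PowerSeries.map (frob F) f, by
    have h := Filter.Tendsto.pow (show Filter.Tendsto _ _ _ from f.2) (Fintype.card F)
    rw [zero_pow Fintype.card_ne_zero] at h
    exact h⟩
  map_add' f g := Subtype.ext (by simp)
  map_smul' p f := Subtype.ext (by
    simp [Algebra.smul_def, PowerSeries.algebraMap_apply', polyFrob])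

/-- The action of `ℕ` on `C∞` by the powers of the `q`-Frobenius; it fixes the commutation rule
of the skew polynomials below. -/
instance frobAction : MulSemiringAction (Multiplicative ℕ) (CInf F) :=
  MulSemiringAction.compHom (CInf F) (powersHom (CInf F →+* CInf F) (frob F))

/-- The ring `C∞{τ}` of skew polynomials in `τ`, with `τ a = a ^ q τ`. -/
abbrev SkewRing : Type _ := SkewPolynomial (CInf F)

end Rings

section Cohomology

/-! A left module over `C∞[T, τ]` is given as a `C∞[T]`-module `M` with a map `τ` on `M` that is
semilinear for the action `polyFrob` of `τ` on `C∞[T]`. -/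

variable {F : Type*} [Field F] [Fintype F]
variable {M : Type*} [AddCommGroup M] [Module (CInf F)[X] M] (τ : M →ₛₗ[polyFrob F] M)

/-- The action `m ⊗ z ↦ τ(m) ⊗ τ(z)` of `τ` on `M{T} = M ⊗ C∞{T}`. -/
def tensorTau : M ⊗[(CInf F)[X]] Tate F →ₛₗ[polyFrob F] M ⊗[(CInf F)[X]] Tate F :=
  TensorProduct.map τ (tateFrob F)

lemma polyFrob_algebraMap (p : F[X]) :
    polyFrob F (algebraMap F[X] (CInf F)[X] p) = algebraMap F[X] (CInf F)[X] p := by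
  change ((p.map (algebraMap F (CInf F))).map (frob F)) = p.map (algebraMap F (CInf F))
  rw [Polynomial.map_map]
  congr 1
  exact (FiniteField.frobeniusAlgHom F (CInf F)).comp_algebraMap

/-- `F[T]` acts on `M{T}` through the inclusion `F[T] ⊆ C∞[T]`. -/
instance tensorModule : Module F[X] (M ⊗[(CInf F)[X]] Tate F) :=
  Module.compHom _ (algebraMap F[X] (CInf F)[X])

/-- `F[T]` acts on `Hom(M, C∞{T})` through the inclusion `F[T] ⊆ C∞[T]`. -/
instance homModule : Module F[X] (M →ₗ[(CInf F)[X]] Tate F) :=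
  Module.compHom _ (algebraMap F[X] (CInf F)[X])

/-- `H¹(M) = M{T}^τ`, the `F[T]`-module of the `τ`-invariant elements of `M{T}`. -/
def HUpper : Submodule F[X] (M ⊗[(CInf F)[X]] Tate F) where
  carrier := {y | tensorTau τ y = y}
  add_mem' {x y} hx hy := by
    rw [Set.mem_ofPred_eq] at *
    rw [map_add, hx, hy]
  zero_mem' := map_zero (tensorTau τ)
  smul_mem' p y hy := by
    rw [Set.mem_ofPred_eq] at *
    change tensorTau τ (algebraMap F[X] (CInf F)[X] p • y) = algebraMap F[X] (CInf F)[X] p • y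
    rw [map_smulₛₗ, hy, polyFrob_algebraMap]

/-- `H₁(M) = Hom_{C∞[T, τ]}(M, C∞{T})`, the `F[T]`-module of the `C∞[T]`-linear maps
`M → C∞{T}` that commute with `τ`. -/
def HLower : Submodule F[X] (M →ₗ[(CInf F)[X]] Tate F) where
  carrier := {φ | ∀ m, φ (τ m) = tateFrob F (φ m)}
  add_mem' {φ ψ} hφ hψ m := by
    rw [LinearMap.add_apply, LinearMap.add_apply, hφ m, hψ m, map_add]
  zero_mem' m := (map_zero (tateFrob F)).symm
  smul_mem' p φ hφ m := by
    change algebraMap F[X] (CInf F)[X] p • φ (τ m) =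
      tateFrob F (algebraMap F[X] (CInf F)[X] p • φ m)
    rw [map_smulₛₗ, hφ m, polyFrob_algebraMap]

/-- `h¹(M)`, the rank of the `F[T]`-module `H¹(M)`. -/
def hUpper : Cardinal := Module.rank F[X] (HUpper τ)

/-- `h₁(M)`, the rank of the `F[T]`-module `H₁(M)`. -/
def hLower : Cardinal := Module.rank F[X] (HLower τ)

end Cohomology

section Motive

variable {F : Type*} [Field F] [Fintype F] {n : ℕ} (A N : Matrix (Fin n) (Fin n) (CInf F))

/-- The matrix `(θ I + N) + A τ + I τ²` over `C∞{τ}`. -/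
def tMatrix : Matrix (Fin n) (Fin n) (SkewRing F) :=
  (Matrix.scalar (Fin n) (CInf.theta F) + N).map SkewPolynomial.C
    + A.map (fun a ↦ SkewPolynomial.C a * SkewPolynomial.X)
    + Matrix.scalar (Fin n) (SkewPolynomial.X ^ 2)

/-- The action of `T` on the free left `C∞{τ}`-module with basis `e₁, …, eₙ` (the standard basis
of the rows of length `n`) with `T e = (θ I + N) e + A τ e + τ² e` for the column `e` of the
`eᵢ`: on a row `v`, which stands for `∑ vᵢ eᵢ`, it is `v ↦ v (θ I + N + A τ + I τ²)`. -/
def tAction : Module.End (CInf F) (Fin n → SkewRing F) :=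
  (Matrix.vecMulLinear (tMatrix A N)).restrictScalars (CInf F)

/-- The module `M(A, N)`: the free left `C∞{τ}`-module with basis `e₁, …, eₙ`, on which `T` acts
`C∞{τ}`-linearly by `T e = (θ I + N) e + A τ e + τ² e`. It is a `C∞[T]`-module. -/
abbrev Motive : Type _ := Module.AEval' (tAction A N)

/-- The left multiplication by `τ` on the rows over `C∞{τ}`. -/
def rowTau : (Fin n → SkewRing F) →+ (Fin n → SkewRing F) where
  toFun v i := SkewPolynomial.X * v i
  map_zero' := by ext1 i; simp
  map_add' v w := by ext1 i; simp [mul_add]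

lemma skew_X_mul_smul (c : CInf F) (p : SkewRing F) :
    SkewPolynomial.X * (c • p) = frob F c • (SkewPolynomial.X * p) := by
  induction p using SkewPolynomial.induction with
  | h0 => simp
  | ha k r p _ _ hp =>
    rw [smul_add, mul_add, mul_add, smul_add, hp, ← map_smul, SkewPolynomial.X_mul_monomial,
      SkewPolynomial.X_mul_monomial, ← map_smul, smul_eq_mul, smul_eq_mul, map_mul]
    rfl

lemma rowTau_smul (c : CInf F) (v : Fin n → SkewRing F) :
    rowTau (c • v) = frob F c • rowTau v :=
  funext fun i ↦ skew_X_mul_smul c (v i)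

lemma rowTau_tAction (v : Fin n → SkewRing F) :
    rowTau (tAction A N v) = tAction A N (rowTau v) :=
  ((Matrix.vecMulLinear (tMatrix A N)).map_smul (SkewPolynomial.X : SkewRing F) v).symm

/-- The left multiplication by `τ` on `M(A, N)`. -/
def motiveTau : Motive A N →ₛₗ[polyFrob F] Motive A N where
  toFun v := Module.AEval'.of (tAction A N) (rowTau ((Module.AEval'.of (tAction A N)).symm v))
  map_add' v w := by simp
  map_smul' p v := by
    induction p using Polynomial.induction_on' with
    | add p q hp hq => simp only [add_smul, map_add, hp, hq]
    | monomial k c =>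
      have hpow (w : Fin n → SkewRing F) :
          rowTau ((tAction A N ^ k) w) = (tAction A N ^ k) (rowTau w) := by
        induction k with
        | zero => rfl
        | succ k ih => rw [pow_succ', Module.End.mul_apply, rowTau_tAction, ih]; rfl
      have hp : polyFrob F (monomial k c) = monomial k (frob F c) := by simp [polyFrob]
      rw [hp, ← C_mul_X_pow_eq_monomial, ← C_mul_X_pow_eq_monomial, mul_smul, mul_smul,
        Module.AEval.C_smul, Module.AEval.C_smul]
      obtain ⟨w, rfl⟩ := (Module.AEval'.of (tAction A N)).surjective v
      rw [Module.AEval'.X_pow_smul_of, LinearEquiv.symm_apply_apply, Module.AEval'.X_pow_smul_of,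
        map_smul, LinearEquiv.symm_apply_apply, rowTau_smul, Module.End.smul_def, hpow, map_smul]
      rfl

end Motive

end AndersonMotive

end

namespace AndersonMotive

/-! ### Exponents of absolute values in base `|θ|` -/

section Ultrametric

variable {K : Type*} [NormedField K] {t : ℝ}

/-! A map in `H₁(M)` is determined by the images of `e₁, e₂`. The coefficients of these two series
form points `zₙ` of `C∞²` that tend to `0` and satisfy `T z₀ = 0` and `T zₙ₊₁ = zₙ`, for the
additive action of `T` on `C∞²`. In the coordinates `(x, w) = (x, θ³ y)` this action, divided by
`θ`, reduces on the closed unit disc to `(x + x², w + x²)`, whose kernel is `{(0, 0), (1, 1)}`. The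
point `(1, 1)` lifts to a torsion point, and a contraction argument divides it by `T` again and
again with terms of size at most `|θ|⁻ⁿ` (`exists_isHomSeq`); this gives a map `φ`. Conversely, the
terms of any such sequence are eventually in the open unit disc. `HomRegion` is stable under `T` and
omits `0`, so no `T zₙ` lies in it. This forces the term before a small one to be small or close to
`z₀(φ)` (`IsHomSeq.small_or_sub_small`). In the second case `T^N φ` is subtracted. When all terms
are small the sequence is zero, since `T` is injective on the open disc. Hence `H₁(M)` is free on
`φ`.

For `H¹(M)`, an invariant is written in the basis `eᵢ, τ eᵢ` and the coordinates at the `eᵢ` are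
eliminated. The remaining coefficients satisfy `(uₙ⁴, vₙ⁴) = G(uₙ₊₁, vₙ₊₁)` and `G(u₀, v₀) = 0`,
with `G` given by `cohFst` and `cohSnd`. In a small ball `G` vanishes only at `0`, and a point of
this ball leads back to the ball or into `CohRegion`, which is stable and omits `0`. A nonzero term
in the ball would thus have only nonzero terms before it, against `G(u₀, v₀) = 0`. So the terms
vanish for large `n`, hence for all `n`. -/

lemma norm_mul_pow_eq (ht : 1 < t) {c x : K} {k r u : ℝ} (hc : ‖c‖ = t ^ k) (hx : ‖x‖ = t ^ r)
    (n : ℕ) (h : k + n * r = u) : ‖c * x ^ n‖ = t ^ u := by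
  rw [norm_mul, norm_pow, hc, hx, ← Real.rpow_mul_natCast (by linarith), ← Real.rpow_add (by linarith),
    ← h, mul_comm r]

lemma norm_mul_pow_le (ht : 1 < t) {c x : K} {k r u : ℝ} (hc : ‖c‖ = t ^ k) (hx : ‖x‖ ≤ t ^ r)
    (n : ℕ) (h : k + n * r ≤ u) : ‖c * x ^ n‖ ≤ t ^ u := by
  calc ‖c * x ^ n‖ = t ^ k * ‖x‖ ^ n := by rw [norm_mul, norm_pow, hc]
    _ ≤ t ^ k * (t ^ r) ^ n := by gcongr
    _ = t ^ (k + n * r) := by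
      rw [← Real.rpow_mul_natCast (by linarith), ← Real.rpow_add (by linarith), mul_comm r]
    _ ≤ t ^ u := Real.rpow_le_rpow_of_exponent_le ht.le h

lemma norm_mul_pow_lt (ht : 1 < t) {c x : K} {k r u : ℝ} (hc : ‖c‖ = t ^ k) (hx : ‖x‖ ≤ t ^ r)
    (n : ℕ) (h : k + n * r < u) : ‖c * x ^ n‖ < t ^ u :=
  (norm_mul_pow_le ht hc hx n le_rfl).trans_lt (Real.rpow_lt_rpow_of_exponent_lt ht h)

lemma norm_mul_pow_lt_of_lt (ht : 1 < t) {c x : K} {k r u : ℝ} (hc : ‖c‖ = t ^ k)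
    (hx : ‖x‖ < t ^ r) {n : ℕ} (hn : n ≠ 0) (h : k + n * r ≤ u) : ‖c * x ^ n‖ < t ^ u := by
  have hk : 0 < t ^ k := Real.rpow_pos_of_pos (by linarith) _
  calc ‖c * x ^ n‖ = t ^ k * ‖x‖ ^ n := by rw [norm_mul, norm_pow, hc]
    _ < t ^ k * (t ^ r) ^ n := by gcongr
    _ = t ^ (k + n * r) := by
      rw [← Real.rpow_mul_natCast (by linarith), ← Real.rpow_add (by linarith), mul_comm r]
    _ ≤ t ^ u := Real.rpow_le_rpow_of_exponent_le ht.le h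

lemma exists_norm_eq_rpow (ht : 1 < t) {x : K} (hx : x ≠ 0) : ∃ a : ℝ, ‖x‖ = t ^ a :=
  ⟨Real.logb t ‖x‖, (Real.rpow_logb (by linarith) ht.ne' (norm_pos_iff.2 hx)).symm⟩

lemma exists_norm_eq_rpow_of_lt (ht : 1 < t) {x : K} {r : ℝ} (hx : t ^ r < ‖x‖) :
    ∃ a : ℝ, r < a ∧ ‖x‖ = t ^ a := by
  obtain ⟨a, ha⟩ := exists_norm_eq_rpow ht
    (norm_pos_iff.1 ((Real.rpow_pos_of_pos (by linarith) r).trans hx))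
  exact ⟨a, (Real.rpow_lt_rpow_left_iff ht).1 (ha ▸ hx), ha⟩

lemma exists_norm_eq_rpow_of_le (ht : 1 < t) {x : K} {r : ℝ} (hx : t ^ r ≤ ‖x‖) :
    ∃ a : ℝ, r ≤ a ∧ ‖x‖ = t ^ a := by
  obtain ⟨a, ha⟩ := exists_norm_eq_rpow ht
    (norm_pos_iff.1 ((Real.rpow_pos_of_pos (by linarith) r).trans_le hx))
  exact ⟨a, (Real.rpow_le_rpow_left_iff ht).1 (ha ▸ hx), ha⟩

lemma norm_eq_rpow_of_pow (ht : 1 < t) {x y : K} {r u : ℝ} {n : ℕ} (hn : n ≠ 0) (h : x ^ n = y)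
    (hy : ‖y‖ = t ^ r) (hu : n * u = r) : ‖x‖ = t ^ u := by
  have h0 : (0 : ℝ) ≤ t := by linarith
  rw [← pow_left_inj₀ (norm_nonneg x) (Real.rpow_nonneg h0 u) hn, ← norm_pow, h, hy,
    ← Real.rpow_mul_natCast h0, ← hu, mul_comm]

lemma norm_lt_rpow_of_pow (ht : 1 < t) {x y : K} {r u : ℝ} {n : ℕ} (hn : n ≠ 0) (h : x ^ n = y)
    (hy : ‖y‖ < t ^ r) (hu : r ≤ n * u) : ‖x‖ < t ^ u := by
  have h0 : (0 : ℝ) ≤ t := by linarith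
  rw [← pow_lt_pow_iff_left₀ (norm_nonneg x) (Real.rpow_nonneg h0 u) hn, ← norm_pow, h,
    ← Real.rpow_mul_natCast h0, mul_comm]
  exact hy.trans_le (Real.rpow_le_rpow_of_exponent_le ht.le hu)

lemma norm_theta_eq {θ : K} : ‖θ‖ = ‖θ‖ ^ (1 : ℝ) := (Real.rpow_one _).symm

lemma norm_theta_pow {θ : K} (n : ℕ) : ‖θ ^ n‖ = ‖θ‖ ^ (n : ℝ) := by
  rw [norm_pow, Real.rpow_natCast]

lemma norm_theta_inv_pow {θ : K} (n : ℕ) : ‖θ⁻¹ ^ n‖ = ‖θ‖ ^ (-n : ℝ) := by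
  rw [norm_pow, norm_inv, Real.rpow_neg (norm_nonneg _), Real.rpow_natCast, inv_pow]

lemma norm_one_eq_rpow : ‖(1 : K)‖ = t ^ (0 : ℝ) := by rw [norm_one, Real.rpow_zero]

variable [IsUltrametricDist K]

lemma norm_add_lt_of_lt {x y : K} {r : ℝ} (hx : ‖x‖ < r) (hy : ‖y‖ < r) : ‖x + y‖ < r :=
  (IsUltrametricDist.norm_add_le_max x y).trans_lt (max_lt hx hy)

lemma norm_add_le_of_le {x y : K} {r : ℝ} (hx : ‖x‖ ≤ r) (hy : ‖y‖ ≤ r) : ‖x + y‖ ≤ r :=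
  (IsUltrametricDist.norm_add_le_max x y).trans (max_le hx hy)

lemma norm_add_eq_of_lt {x y : K} {r : ℝ} (hx : ‖x‖ = r) (hy : ‖y‖ < r) : ‖x + y‖ = r := by
  rw [IsUltrametricDist.norm_add_eq_max_of_norm_ne_norm (by rw [hx]; exact hy.ne'), hx,
    max_eq_left hy.le]

end Ultrametric

/-! ### Sequences of `T`-division points in `C∞²` -/

section Homology

variable {K : Type*} [NormedField K] (θ : K)

/-- The first coordinate of the action of `T` on `C∞²` in the coordinates `(x, θ³ y)`. -/
def homFst (x w : K) : K := θ * x + θ * x ^ 2 + w ^ 2 + x ^ 4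

/-- The second coordinate of the action of `T` on `C∞²` in the coordinates `(x, θ³ y)`. -/
def homSnd (x w : K) : K := θ * w + θ * x ^ 2 + θ⁻¹ ^ 9 * w ^ 4

/-- Where the first coordinate dominates. -/
def HomRegionFst (x w : K) : Prop :=
  ∃ a : ℝ, 1 / 2 < a ∧ ‖x‖ = ‖θ‖ ^ a ∧ ‖w‖ < ‖θ‖ ^ (2 * a)

/-- Where the second coordinate dominates, below the size of the large torsion points. -/
def HomRegionSnd (x w : K) : Prop :=
  ∃ b : ℝ, 1 ≤ b ∧ b < 3 ∧ ‖w‖ = ‖θ‖ ^ b ∧ ‖x‖ ≤ ‖θ‖ ^ (b / 2)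

/-- The region from which the action of `T` never leads to `0`. -/
def HomRegion (x w : K) : Prop := HomRegionFst θ x w ∨ HomRegionSnd θ x w

variable {θ} {x w : K}

/-- In characteristic 2 the terms `w ^ 2 + x ^ 4` form a square, so both coordinates are governed by
the one quantity `x ^ 2 + w`. -/
lemma homFst_eq (h2 : (2 : K) = 0) :
    homFst θ x w = 1 * (x ^ 2 + w) ^ 2 + (θ * x ^ 1 + θ * x ^ 2) := by
  rw [homFst]; linear_combination (- x ^ 2 * w) * h2

lemma homSnd_eq : homSnd θ x w = θ * (x ^ 2 + w) ^ 1 + θ⁻¹ ^ 9 * w ^ 4 := by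
  rw [homSnd]; ring

lemma not_homRegion_zero (ht : 1 < ‖θ‖) : ¬ HomRegion θ 0 0 := by
  have h (r : ℝ) : (0 : ℝ) ≠ ‖θ‖ ^ r := (Real.rpow_pos_of_pos (by linarith) r).ne
  rintro (⟨a, -, h1, -⟩ | ⟨a, -, -, h1, -⟩) <;> exact h _ (norm_zero (E := K) ▸ h1)

/-- The size of `x` does not matter: once it exceeds the square root of `‖w‖`, the first coordinate
dominates. -/
lemma homRegion_of_snd (ht : 1 < ‖θ‖) {b : ℝ} (hb : 1 ≤ b) (hb' : b < 3) (hw : ‖w‖ = ‖θ‖ ^ b) :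
    HomRegion θ x w := by
  rcases le_or_gt ‖x‖ (‖θ‖ ^ (b / 2)) with h | h
  · exact .inr ⟨b, hb, hb', hw, h⟩
  · obtain ⟨a, hab, ha⟩ := exists_norm_eq_rpow_of_lt ht h
    exact .inl ⟨a, by linarith, ha, hw ▸ Real.rpow_lt_rpow_of_exponent_lt ht (by linarith)⟩

variable [IsUltrametricDist K]

/-- The term `x ^ 4` wins and the exponent `a` becomes `4 * a`; `1 / 2 < a` is exactly what makes `θ
* x ^ 2` smaller. -/
lemma HomRegionFst.step (ht : 1 < ‖θ‖) (h2 : (2 : K) = 0) (h : HomRegionFst θ x w) :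
    HomRegionFst θ (homFst θ x w) (homSnd θ x w) := by
  obtain ⟨a, ha, hx, hw⟩ := h
  have hs : ‖x ^ 2 + w‖ = ‖θ‖ ^ (2 * a) := norm_add_eq_of_lt
    (by simpa using norm_mul_pow_eq ht norm_one_eq_rpow hx 2 (zero_add _)) hw
  refine ⟨4 * a, by linarith, ?_, ?_⟩
  · rw [homFst_eq h2]
    refine norm_add_eq_of_lt (norm_mul_pow_eq ht norm_one_eq_rpow hs 2 (by push_cast; ring))
      (norm_add_lt_of_lt ?_ ?_)
    · exact norm_mul_pow_lt ht norm_theta_eq hx.le 1 (by push_cast; linarith)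
    · exact norm_mul_pow_lt ht norm_theta_eq hx.le 2 (by push_cast; linarith)
  · rw [homSnd_eq]
    refine norm_add_lt_of_lt ?_ ?_
    · exact norm_mul_pow_lt ht norm_theta_eq hs.le 1 (by push_cast; linarith)
    · exact norm_mul_pow_lt ht (norm_theta_inv_pow 9) hw.le 4 (by push_cast; linarith)

/-- At `‖x ^ 2 + w‖ = ‖θ‖ ^ ((1 + b) / 2)` the square of `x ^ 2 + w` reaches the bound for `θ * x ^
2`. Off this threshold one of the two dominates the first coordinate. On it they may cancel, but the
second coordinate then has exponent exactly `(3 + b) / 2`; the bound `b < 3` keeps this below `3`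
and makes `θ⁻¹ ^ 9 * w ^ 4` negligible. -/
lemma HomRegionSnd.step (ht : 1 < ‖θ‖) (h2 : (2 : K) = 0) (h : HomRegionSnd θ x w) :
    HomRegion θ (homFst θ x w) (homSnd θ x w) := by
  obtain ⟨b, hb, hb', hw, hx⟩ := h
  rcases lt_trichotomy ‖x ^ 2 + w‖ (‖θ‖ ^ ((1 + b) / 2)) with hs | hs | hs
  · have hx2 : ‖x ^ 2‖ = ‖θ‖ ^ b := by
      have : x ^ 2 = -w + (x ^ 2 + w) := by ring
      rw [this]
      exact norm_add_eq_of_lt (by rwa [norm_neg])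
        (hs.trans_le (Real.rpow_le_rpow_of_exponent_le ht.le (by linarith)))
    have hx : ‖x‖ = ‖θ‖ ^ (b / 2) :=
      norm_eq_rpow_of_pow ht two_ne_zero rfl hx2 (by push_cast; ring)
    refine .inl ⟨1 + b, by linarith, ?_, ?_⟩
    · rw [homFst_eq h2, add_comm, add_comm (θ * x ^ 1), add_assoc]
      refine norm_add_eq_of_lt (norm_mul_pow_eq ht norm_theta_eq hx 2 (by push_cast; ring))
        (norm_add_lt_of_lt ?_ ?_)
      · exact norm_mul_pow_lt ht norm_theta_eq hx.le 1 (by push_cast; linarith)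
      · exact norm_mul_pow_lt_of_lt ht norm_one_eq_rpow hs two_ne_zero (by push_cast; linarith)
    · rw [homSnd_eq]
      refine norm_add_lt_of_lt ?_ ?_
      · exact norm_mul_pow_lt ht norm_theta_eq hs.le 1 (by push_cast; linarith)
      · exact norm_mul_pow_lt ht (norm_theta_inv_pow 9) hw.le 4 (by push_cast; linarith)
  · refine homRegion_of_snd ht (b := (3 + b) / 2) (by linarith) (by linarith) ?_
    rw [homSnd_eq]
    exact norm_add_eq_of_lt (norm_mul_pow_eq ht norm_theta_eq hs 1 (by push_cast; ring))
      (norm_mul_pow_lt ht (norm_theta_inv_pow 9) hw.le 4 (by push_cast; linarith))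
  · obtain ⟨c, hc, hs⟩ := exists_norm_eq_rpow_of_lt ht hs
    refine .inl ⟨2 * c, by linarith, ?_, ?_⟩
    · rw [homFst_eq h2]
      refine norm_add_eq_of_lt (norm_mul_pow_eq ht norm_one_eq_rpow hs 2 (by push_cast; ring))
        (norm_add_lt_of_lt ?_ ?_)
      · exact norm_mul_pow_lt ht norm_theta_eq hx 1 (by push_cast; linarith)
      · exact norm_mul_pow_lt ht norm_theta_eq hx 2 (by push_cast; linarith)
    · rw [homSnd_eq]
      refine norm_add_lt_of_lt ?_ ?_
      · exact norm_mul_pow_lt ht norm_theta_eq hs.le 1 (by push_cast; linarith)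
      · exact norm_mul_pow_lt ht (norm_theta_inv_pow 9) hw.le 4 (by push_cast; linarith)

lemma HomRegion.step (ht : 1 < ‖θ‖) (h2 : (2 : K) = 0) (h : HomRegion θ x w) :
    HomRegion θ (homFst θ x w) (homSnd θ x w) :=
  h.elim (fun h ↦ .inl (h.step ht h2)) (fun h ↦ h.step ht h2)

lemma homRegion_of_fst_small (ht : 1 < ‖θ‖) (hx : ‖x‖ < 1) (hw : 1 ≤ ‖w‖) (hw' : ‖w‖ < ‖θ‖) :
    HomRegion θ (homFst θ x w) (homSnd θ x w) := by
  obtain ⟨b, hb, hwb⟩ := exists_norm_eq_rpow_of_le ht ((Real.rpow_zero ‖θ‖).trans_le hw)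
  have hb' : b < 1 := (Real.rpow_lt_rpow_left_iff ht).1 (by rwa [← hwb, ← norm_theta_eq])
  have hs : ‖x ^ 2 + w‖ = ‖θ‖ ^ b := by
    rw [add_comm]
    refine norm_add_eq_of_lt hwb (hwb ▸ lt_of_lt_of_le ?_ hw)
    rw [norm_pow]
    exact pow_lt_one₀ (norm_nonneg x) hx two_ne_zero
  refine homRegion_of_snd ht (b := 1 + b) (by linarith) (by linarith) ?_
  rw [homSnd_eq]
  exact norm_add_eq_of_lt (norm_mul_pow_eq ht norm_theta_eq hs 1 (by push_cast; ring))
    (norm_mul_pow_lt ht (norm_theta_inv_pow 9) hwb.le 4 (by push_cast; linarith))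

/-- The hypothesis `h1` excludes the neighbourhood of the reduced torsion point `(1, 1)`. The
threshold `1 / 2 + a` is where `(x ^ 2 + w) ^ 2` can balance `θ * x * (1 + x)`; at the balance the
second coordinate decides. -/
lemma homRegion_of_le_fst (ht : 1 < ‖θ‖) (h2 : (2 : K) = 0) (hx : 1 ≤ ‖x‖) (hx' : ‖x‖ < ‖θ‖)
    (hw : ‖w‖ < ‖θ‖) (h1 : 1 ≤ ‖1 + x‖ ∨ ‖θ‖ ^ (1 / 2 : ℝ) ≤ ‖x ^ 2 + w‖) :
    HomRegion θ (homFst θ x w) (homSnd θ x w) := by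
  obtain ⟨a, ha, hxa⟩ := exists_norm_eq_rpow_of_le ht ((Real.rpow_zero ‖θ‖).trans_le hx)
  have ha' : a < 1 := (Real.rpow_lt_rpow_left_iff ht).1 (by rwa [← hxa, ← norm_theta_eq])
  have hw1 : ‖w‖ ≤ ‖θ‖ ^ (1 : ℝ) := by rw [← norm_theta_eq]; exact hw.le
  rcases lt_trichotomy ‖x ^ 2 + w‖ (‖θ‖ ^ (1 / 2 + a)) with hs | hs | hs
  · have h1x : ‖1 + x‖ = ‖θ‖ ^ a := by
      -- Only for `a = 0` can `1 + x` be smaller than `x`, and `h1` rules this out.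
      rcases ha.eq_or_lt with rfl | ha
      · rw [add_zero] at hs
        have h1 := h1.resolve_right hs.not_ge
        rw [Real.rpow_zero] at hxa ⊢
        exact le_antisymm (norm_add_le_of_le norm_one.le hxa.le) h1
      · rw [add_comm]
        refine norm_add_eq_of_lt hxa ?_
        rw [norm_one]
        exact Real.one_lt_rpow ht ha
    refine .inl ⟨1 + 2 * a, by linarith, ?_, ?_⟩
    · have : homFst θ x w = (θ * x ^ 1) * (1 + x) ^ 1 + 1 * (x ^ 2 + w) ^ 2 := by
        rw [homFst_eq h2]; ring
      rw [this]
      refine norm_add_eq_of_lt (norm_mul_pow_eq ht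
        (norm_mul_pow_eq ht norm_theta_eq hxa 1 rfl) h1x 1 (by push_cast; ring)) ?_
      exact norm_mul_pow_lt_of_lt ht norm_one_eq_rpow hs two_ne_zero (by push_cast; linarith)
    · rw [homSnd_eq]
      refine norm_add_lt_of_lt ?_ ?_
      · exact norm_mul_pow_lt ht norm_theta_eq hs.le 1 (by push_cast; linarith)
      · exact norm_mul_pow_lt ht (norm_theta_inv_pow 9) hw1 4 (by push_cast; linarith)
  · refine homRegion_of_snd ht (b := 3 / 2 + a) (by linarith) (by linarith) ?_
    rw [homSnd_eq]
    exact norm_add_eq_of_lt (norm_mul_pow_eq ht norm_theta_eq hs 1 (by push_cast; ring))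
      (norm_mul_pow_lt ht (norm_theta_inv_pow 9) hw1 4 (by push_cast; linarith))
  · obtain ⟨c, hc, hs⟩ := exists_norm_eq_rpow_of_lt ht hs
    refine .inl ⟨2 * c, by linarith, ?_, ?_⟩
    · rw [homFst_eq h2]
      refine norm_add_eq_of_lt (norm_mul_pow_eq ht norm_one_eq_rpow hs 2 (by push_cast; ring))
        (norm_add_lt_of_lt ?_ ?_)
      · exact norm_mul_pow_lt ht norm_theta_eq hxa.le 1 (by push_cast; linarith)
      · exact norm_mul_pow_lt ht norm_theta_eq hxa.le 2 (by push_cast; linarith)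
    · rw [homSnd_eq]
      refine norm_add_lt_of_lt ?_ ?_
      · exact norm_mul_pow_lt ht norm_theta_eq hs.le 1 (by push_cast; linarith)
      · exact norm_mul_pow_lt ht (norm_theta_inv_pow 9) hw1 4 (by push_cast; linarith)

lemma norm_hom_lt (ht : 1 < ‖θ‖) (hx : ‖x‖ < 1) (hw : ‖w‖ < 1) :
    ‖homFst θ x w‖ < ‖θ‖ ∧ ‖homSnd θ x w‖ < ‖θ‖ := by
  rw [← Real.rpow_zero ‖θ‖] at hx hw
  rw [norm_theta_eq (θ := θ)]
  simp only [← norm_theta_eq]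
  have key {c z : K} {k : ℝ} {n : ℕ} (hc : ‖c‖ = ‖θ‖ ^ k) (hk : k ≤ 1) (hn : n ≠ 0)
      (hz : ‖z‖ < ‖θ‖ ^ (0 : ℝ)) : ‖c * z ^ n‖ < ‖θ‖ := by
    conv_rhs => rw [norm_theta_eq (θ := θ)]
    exact norm_mul_pow_lt_of_lt ht hc hz hn (by linarith)
  constructor
  · have : homFst θ x w = θ * x ^ 1 + θ * x ^ 2 + 1 * w ^ 2 + 1 * x ^ 4 := by rw [homFst]; ring
    rw [this]
    refine norm_add_lt_of_lt (norm_add_lt_of_lt (norm_add_lt_of_lt ?_ ?_) ?_) ?_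
    · exact key norm_theta_eq le_rfl one_ne_zero hx
    · exact key norm_theta_eq le_rfl two_ne_zero hx
    · exact key norm_one_eq_rpow zero_le_one two_ne_zero hw
    · exact key norm_one_eq_rpow zero_le_one four_ne_zero hx
  · have : homSnd θ x w = θ * w ^ 1 + θ * x ^ 2 + θ⁻¹ ^ 9 * w ^ 4 := by rw [homSnd]; ring
    rw [this]
    refine norm_add_lt_of_lt (norm_add_lt_of_lt ?_ ?_) ?_
    · exact key norm_theta_eq le_rfl one_ne_zero hw
    · exact key norm_theta_eq le_rfl two_ne_zero hx
    · exact key (norm_theta_inv_pow 9) (by norm_num) four_ne_zero hw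

/-- After division by `θ` the action of `T` is the identity plus terms of degree at least 2 with
integral coefficients, so on the kernel `m ≤ m ^ 2` for the larger size `m < 1`. -/
lemma eq_zero_of_hom_eq_zero (ht : 1 < ‖θ‖) (hx : ‖x‖ < 1) (hw : ‖w‖ < 1)
    (h1 : homFst θ x w = 0) (h2 : homSnd θ x w = 0) : x = 0 ∧ w = 0 := by
  have hθ : θ ≠ 0 := norm_pos_iff.1 (by linarith)
  set m := max ‖x‖ ‖w‖ with hm
  have hm1 : m < 1 := max_lt hx hw
  have hm0 : 0 ≤ m := (norm_nonneg x).trans (le_max_left _ _)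
  have hi : ‖θ⁻¹‖ ≤ 1 := by rw [norm_inv]; exact inv_le_one_of_one_le₀ ht.le
  have key {c z : K} {n : ℕ} (hc : ‖c‖ ≤ 1) (hn : 2 ≤ n) (hz : ‖z‖ ≤ m) :
      ‖c * z ^ n‖ ≤ m ^ 2 := by
    rw [norm_mul, norm_pow]
    calc ‖c‖ * ‖z‖ ^ n ≤ 1 * m ^ n := by gcongr
      _ ≤ m ^ 2 := by rw [one_mul]; exact pow_le_pow_of_le_one hm0 hm1.le hn
  have hx' : x = -(1 * x ^ 2 + θ⁻¹ * w ^ 2 + θ⁻¹ * x ^ 4) := by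
    rw [homFst] at h1
    apply mul_left_cancel₀ hθ
    field_simp
    linear_combination h1
  have hw' : w = -(1 * x ^ 2 + θ⁻¹ ^ 10 * w ^ 4) := by
    rw [homSnd] at h2
    apply mul_left_cancel₀ hθ
    have : θ * -(1 * x ^ 2 + θ⁻¹ ^ 10 * w ^ 4) =
      -(θ * x ^ 2) - (θ * θ⁻¹) * θ⁻¹ ^ 9 * w ^ 4 := by ring
    rw [this, mul_inv_cancel₀ hθ]
    linear_combination h2
  have hmm : m ≤ m ^ 2 := by
    refine max_le ?_ ?_
    · rw [hx', norm_neg]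
      refine norm_add_le_of_le (norm_add_le_of_le ?_ ?_) ?_
      · exact key norm_one.le le_rfl (le_max_left _ _)
      · exact key hi le_rfl (le_max_right _ _)
      · exact key hi (by norm_num) (le_max_left _ _)
    · rw [hw', norm_neg]
      refine norm_add_le_of_le ?_ ?_
      · exact key norm_one.le le_rfl (le_max_left _ _)
      · exact key (by rw [norm_pow]; exact pow_le_one₀ (norm_nonneg _) hi) (by norm_num)
          (le_max_right _ _)
  have hm' : m = 0 := by nlinarith
  exact ⟨norm_le_zero_iff.1 ((le_max_left _ _).trans hm'.le),
    norm_le_zero_iff.1 ((le_max_right _ _).trans hm'.le)⟩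

/-- The sequences `(xₙ, wₙ)` with `T (xₙ₊₁, wₙ₊₁) = (xₙ, wₙ)` and `T (x₀, w₀) = 0`. -/
structure IsHomSeq (θ : K) (x w : ℕ → K) : Prop where
  fst_zero : homFst θ (x 0) (w 0) = 0
  snd_zero : homSnd θ (x 0) (w 0) = 0
  fst_succ n : homFst θ (x (n + 1)) (w (n + 1)) = x n
  snd_succ n : homSnd θ (x (n + 1)) (w (n + 1)) = w n

variable {x w : ℕ → K}

/-- Iterating `T` leads from each term to `0`, which is outside the stable region. -/
lemma IsHomSeq.not_homRegion (h : IsHomSeq θ x w) (ht : 1 < ‖θ‖) (h2 : (2 : K) = 0) (n : ℕ) :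
    ¬ HomRegion θ (homFst θ (x n) (w n)) (homSnd θ (x n) (w n)) := by
  induction n with
  | zero => rw [h.fst_zero, h.snd_zero]; exact not_homRegion_zero ht
  | succ n ih => rw [h.fst_succ, h.snd_succ]; exact fun hn ↦ ih (hn.step ht h2)

lemma IsHomSeq.eq_zero (h : IsHomSeq θ x w) (ht : 1 < ‖θ‖) (hs : ∀ n, ‖x n‖ < 1 ∧ ‖w n‖ < 1)
    (n : ℕ) : x n = 0 ∧ w n = 0 := by
  induction n with
  | zero => exact eq_zero_of_hom_eq_zero ht (hs 0).1 (hs 0).2 h.fst_zero h.snd_zero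
  | succ n ih =>
    exact eq_zero_of_hom_eq_zero ht (hs _).1 (hs _).2 ((h.fst_succ n).trans ih.1)
      ((h.snd_succ n).trans ih.2)

/-- Smallness at `n + 1` bounds the term `n` by `‖θ‖`. Since its image under `T` avoids `HomRegion`,
only neighbourhoods of `(0, 0)` and `(1, 1)` remain, and `(ξ, ω)` is a torsion point near the
latter. -/
lemma IsHomSeq.small_or_sub_small (h : IsHomSeq θ x w) (ht : 1 < ‖θ‖) (h2 : (2 : K) = 0) {n : ℕ}
    (hs : ‖x (n + 1)‖ < 1 ∧ ‖w (n + 1)‖ < 1) {ξ ω : K} (h1 : homFst θ ξ ω = 0)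
    (h1' : homSnd θ ξ ω = 0) (hξ : ‖1 + ξ‖ < 1) (hω : ‖1 + ω‖ < 1) :
    (‖x n‖ < 1 ∧ ‖w n‖ < 1) ∨ (‖x n - ξ‖ < 1 ∧ ‖w n - ω‖ < 1) := by
  have hlt := norm_hom_lt ht hs.1 hs.2
  rw [h.fst_succ, h.snd_succ] at hlt
  have hn := h.not_homRegion ht h2 n
  rcases lt_or_ge ‖x n‖ 1 with hx | hx
  · refine .inl ⟨hx, ?_⟩
    by_contra! hw
    exact hn (homRegion_of_fst_small ht hx hw hlt.2)
  · have h3 : ‖1 + x n‖ < 1 ∧ ‖x n ^ 2 + w n‖ < ‖θ‖ ^ (1 / 2 : ℝ) := by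
      by_contra h3
      rw [not_and_or, not_lt, not_lt] at h3
      exact hn (homRegion_of_le_fst ht h2 hx hlt.1 hlt.2 h3)
    have hx' : ‖x n - ξ‖ < 1 := by
      have : x n - ξ = (1 + x n) + -(1 + ξ) := by ring
      rw [this]
      exact norm_add_lt_of_lt h3.1 (by rwa [norm_neg])
    have hω' : ‖ω‖ < ‖θ‖ := by
      have : ω = -1 + (1 + ω) := by ring
      rw [this]
      exact norm_add_lt_of_lt (by rwa [norm_neg, norm_one]) (hω.trans ht)
    have hw' : ‖w n - ω‖ < ‖θ‖ := by
      rw [sub_eq_add_neg]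
      exact norm_add_lt_of_lt hlt.2 (by rwa [norm_neg])
    refine .inr ⟨hx', ?_⟩
    by_contra! hw
    -- `T` is additive and kills `(ξ, ω)`, so the difference has the same image as the term itself.
    have h4 := homRegion_of_fst_small ht hx' hw hw'
    have e1 : homFst θ (x n - ξ) (w n - ω) = homFst θ (x n) (w n) - homFst θ ξ ω := by
      rw [homFst, homFst, homFst]
      linear_combination (θ * (ξ ^ 2 - x n * ξ) + (ω ^ 2 - w n * ω) +
        (ξ ^ 4 - 2 * ξ ^ 3 * x n + 3 * ξ ^ 2 * x n ^ 2 - 2 * ξ * x n ^ 3)) * h2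
    have e2 : homSnd θ (x n - ξ) (w n - ω) = homSnd θ (x n) (w n) - homSnd θ ξ ω := by
      rw [homSnd, homSnd, homSnd]
      linear_combination (θ * (ξ ^ 2 - x n * ξ) + θ⁻¹ ^ 9 *
        (ω ^ 4 - 2 * ω ^ 3 * w n + 3 * ω ^ 2 * w n ^ 2 - 2 * ω * w n ^ 3)) * h2
    rw [e1, e2, h1, h1', sub_zero, sub_zero] at h4
    exact hn h4

end Homology

/-! ### Sequences of coefficients of the `τ`-invariants -/

section Cohomology

variable {K : Type*} [NormedField K] (θ : K)

/-- The first coordinate of the fourth power of the preceding term. -/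
def cohFst (u v : K) : K := θ ^ 6 * (u + v ^ 2) + θ ^ 5 * u ^ 2 + θ ^ 2 * u ^ 4

/-- The second coordinate of the fourth power of the preceding term. -/
def cohSnd (u v : K) : K := v + θ ^ 2 * (u + v ^ 2) ^ 2

/-- Where the term `u⁴` dominates. -/
def CohRegionFst (u v : K) : Prop :=
  ∃ a : ℝ, 3 / 2 < a ∧ ‖u‖ = ‖θ‖ ^ a ∧ ‖u + v ^ 2‖ < ‖θ‖ ^ (4 * a - 4) ∧
    ‖v‖ < ‖θ‖ ^ (8 * a - 8)

/-- Where the second coordinate is large. -/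
def CohRegionSnd (v : K) : Prop := ∃ b : ℝ, 1 ≤ b ∧ ‖v‖ = ‖θ‖ ^ b

/-- Where `u` dominates in `u + v²`. -/
def CohRegionMid (u v : K) : Prop := ∃ a : ℝ, -(4 / 3) ≤ a ∧ ‖u‖ = ‖θ‖ ^ a ∧ ‖v‖ < ‖θ‖ ^ (a / 2)

/-- Where the second coordinate is between the ball of linearization and the unit disc. -/
def CohRegionAnn (v : K) : Prop := ∃ b : ℝ, -(2 / 3) ≤ b ∧ b < 0 ∧ ‖v‖ = ‖θ‖ ^ b

/-- A region of nonzero points that never lead to `0`. -/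
def CohRegion (u v : K) : Prop :=
  CohRegionFst θ u v ∨ CohRegionSnd θ v ∨ CohRegionMid θ u v ∨ CohRegionAnn θ v

/-- The ball on which the map is dominated by its linear part. -/
def CohBall (u v : K) : Prop := ‖u‖ < ‖θ‖ ^ (-(4 / 3) : ℝ) ∧ ‖v‖ < ‖θ‖ ^ (-(2 / 3) : ℝ)

variable {θ} {u v u' v' : K}

lemma not_cohRegion_zero (ht : 1 < ‖θ‖) : ¬ CohRegion θ 0 0 := by
  have h (r : ℝ) : (0 : ℝ) ≠ ‖θ‖ ^ r := (Real.rpow_pos_of_pos (by linarith) r).ne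
  rintro (⟨a, -, h1, -⟩ | ⟨a, -, h1⟩ | ⟨a, -, h1, -⟩ | ⟨a, -, -, h1⟩) <;>
    exact h _ (norm_zero (E := K) ▸ h1)

lemma norm_sq_lt (ht : 1 < ‖θ‖) {r : ℝ} (h : ‖v‖ < ‖θ‖ ^ (r / 2)) : ‖v ^ 2‖ < ‖θ‖ ^ r := by
  rw [← one_mul (v ^ 2)]
  exact norm_mul_pow_lt_of_lt ht norm_one_eq_rpow h two_ne_zero (by push_cast; linarith)

lemma norm_sq_eq (ht : 1 < ‖θ‖) {r : ℝ} (h : ‖v‖ = ‖θ‖ ^ r) : ‖v ^ 2‖ = ‖θ‖ ^ (2 * r) := by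
  rw [← one_mul (v ^ 2)]
  exact norm_mul_pow_eq ht norm_one_eq_rpow h 2 (by push_cast; ring)

lemma cohRegionMid_of_norm (ht : 1 < ‖θ‖) (h1 : u' ^ 4 = cohFst θ u v)
    (h2 : v' ^ 4 = cohSnd θ u v) {a : ℝ} (ha : -(4 / 3) ≤ a) (hu : ‖cohFst θ u v‖ = ‖θ‖ ^ (4 * a))
    (hv : ‖cohSnd θ u v‖ < ‖θ‖ ^ (2 * a)) : CohRegionMid θ u' v' :=
  ⟨a, ha, norm_eq_rpow_of_pow ht four_ne_zero h1 hu (by push_cast; ring),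
    norm_lt_rpow_of_pow ht four_ne_zero h2 hv (by push_cast; linarith)⟩

variable [IsUltrametricDist K]

/-- The term `θ ^ 2 * u ^ 4` has exponent `2 + 4 * a`, whose fourth root raises `a` by `1 / 2`; `3 /
2 < a` makes it beat `θ ^ 5 * u ^ 2`. -/
lemma CohRegionFst.step (ht : 1 < ‖θ‖) (h : CohRegionFst θ u v) (h1 : u' ^ 4 = cohFst θ u v)
    (h2 : v' ^ 4 = cohSnd θ u v) : CohRegionFst θ u' v' := by
  obtain ⟨a, ha, hu, hs, hv⟩ := h
  have hu' : ‖u'‖ = ‖θ‖ ^ (a + 1 / 2) := by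
    refine norm_eq_rpow_of_pow ht four_ne_zero h1 (r := 2 + 4 * a) ?_ (by push_cast; ring)
    have : cohFst θ u v = θ ^ 2 * u ^ 4 + (θ ^ 6 * (u + v ^ 2) ^ 1 + θ ^ 5 * u ^ 2) := by
      rw [cohFst]; ring
    rw [this]
    refine norm_add_eq_of_lt (norm_mul_pow_eq ht (norm_theta_pow 2) hu 4 (by push_cast; ring))
      (norm_add_lt_of_lt ?_ ?_)
    · exact norm_mul_pow_lt_of_lt ht (norm_theta_pow 6) hs one_ne_zero (by push_cast; linarith)
    · exact norm_mul_pow_lt ht (norm_theta_pow 5) hu.le 2 (by push_cast; linarith)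
  have hv' : ‖v'‖ < ‖θ‖ ^ (2 * a - 3 / 2) := by
    refine norm_lt_rpow_of_pow ht four_ne_zero h2 (r := 8 * a - 6) ?_ (by push_cast; linarith)
    refine norm_add_lt_of_lt ?_ ?_
    · exact hv.trans (Real.rpow_lt_rpow_of_exponent_lt ht (by linarith))
    · exact norm_mul_pow_lt_of_lt ht (norm_theta_pow 2) hs two_ne_zero (by push_cast; linarith)
  refine ⟨a + 1 / 2, by linarith, hu', norm_add_lt_of_lt ?_ ?_, ?_⟩
  · rw [hu']; exact Real.rpow_lt_rpow_of_exponent_lt ht (by linarith)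
  · rw [← one_mul (v' ^ 2)]
    exact norm_mul_pow_lt_of_lt ht norm_one_eq_rpow hv' two_ne_zero (by push_cast; linarith)
  · exact hv'.trans (Real.rpow_lt_rpow_of_exponent_lt ht (by linarith))

/-- Unless `u` is already in the first region, `v ^ 2` dominates `u` and the term `θ ^ 2 * v ^ 4`
raises `b` by `1 / 2`. The threshold `1 + b / 2` comes from `2 * b < 4 * a - 4`. -/
lemma CohRegionSnd.step (ht : 1 < ‖θ‖) (h : CohRegionSnd θ v) (h1 : u' ^ 4 = cohFst θ u v)
    (h2 : v' ^ 4 = cohSnd θ u v) : CohRegion θ u' v' := by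
  obtain ⟨b, hb, hv⟩ := h
  rcases lt_or_ge (‖θ‖ ^ (1 + b / 2)) ‖u‖ with hu | hu
  · obtain ⟨a, ha, hu⟩ := exists_norm_eq_rpow_of_lt ht hu
    refine .inl (CohRegionFst.step ht ⟨a, by linarith, hu, norm_add_lt_of_lt ?_ ?_, ?_⟩ h1 h2)
    · rw [hu]; exact Real.rpow_lt_rpow_of_exponent_lt ht (by linarith)
    · rw [norm_sq_eq ht hv]; exact Real.rpow_lt_rpow_of_exponent_lt ht (by linarith)
    · rw [hv]; exact Real.rpow_lt_rpow_of_exponent_lt ht (by linarith)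
  · have hs : ‖u + v ^ 2‖ = ‖θ‖ ^ (2 * b) := by
      rw [add_comm]
      exact norm_add_eq_of_lt (norm_sq_eq ht hv)
        (hu.trans_lt (Real.rpow_lt_rpow_of_exponent_lt ht (by linarith)))
    refine .inr (.inl ⟨b + 1 / 2, by linarith, norm_eq_rpow_of_pow ht four_ne_zero h2
      (r := 2 + 4 * b) ?_ (by push_cast; ring)⟩)
    rw [cohSnd, add_comm]
    refine norm_add_eq_of_lt (norm_mul_pow_eq ht (norm_theta_pow 2) hs 2 (by push_cast; ring)) ?_
    rw [hv]; exact Real.rpow_lt_rpow_of_exponent_lt ht (by linarith)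

/-- The inequalities `h1` and `h2` say that `θ ^ 6 * (u + v ^ 2)` beats `θ ^ 5 * u ^ 2` and `θ ^ 2 *
u ^ 4`. -/
lemma norm_cohFst_eq_of_lt (ht : 1 < ‖θ‖) {c : ℝ} (hs : ‖u + v ^ 2‖ = ‖θ‖ ^ c) {a : ℝ}
    (hu : ‖u‖ ≤ ‖θ‖ ^ a) (h1 : 2 * a - 1 < c) (h2 : 4 * a - 4 < c) :
    ‖cohFst θ u v‖ = ‖θ‖ ^ (6 + c) := by
  have : cohFst θ u v = θ ^ 6 * (u + v ^ 2) ^ 1 + (θ ^ 5 * u ^ 2 + θ ^ 2 * u ^ 4) := by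
    rw [cohFst]; ring
  rw [this]
  refine norm_add_eq_of_lt (norm_mul_pow_eq ht (norm_theta_pow 6) hs 1 (by push_cast; ring))
    (norm_add_lt_of_lt ?_ ?_)
  · exact norm_mul_pow_lt ht (norm_theta_pow 5) hu 2 (by push_cast; linarith)
  · exact norm_mul_pow_lt ht (norm_theta_pow 2) hu 4 (by push_cast; linarith)

lemma norm_cohSnd_lt (ht : 1 < ‖θ‖) {b c r : ℝ} (hv : ‖v‖ ≤ ‖θ‖ ^ b)
    (hs : ‖u + v ^ 2‖ ≤ ‖θ‖ ^ c) (h1 : b < r) (h2 : 2 + 2 * c < r) : ‖cohSnd θ u v‖ < ‖θ‖ ^ r :=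
  norm_add_lt_of_lt (hv.trans_lt (Real.rpow_lt_rpow_of_exponent_lt ht h1))
    (norm_mul_pow_lt ht (norm_theta_pow 2) hs 2 (by push_cast; linarith))

/-- For `1 ≤ a` the term `θ ^ 2 * u ^ 2` makes the second coordinate large. For `a < 1` the term `θ
^ 6 * u` dominates and `a` becomes `(6 + a) / 4`, which exceeds `3 / 2` as soon as `0 < a`. -/
lemma CohRegionMid.step (ht : 1 < ‖θ‖) (h : CohRegionMid θ u v) (h1 : u' ^ 4 = cohFst θ u v)
    (h2 : v' ^ 4 = cohSnd θ u v) : CohRegion θ u' v' := by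
  obtain ⟨a, ha, hu, hv⟩ := h
  have hs : ‖u + v ^ 2‖ = ‖θ‖ ^ a := norm_add_eq_of_lt hu (norm_sq_lt ht hv)
  rcases le_or_gt 1 a with ha1 | ha1
  · refine .inr (.inl ⟨(1 + a) / 2, by linarith, norm_eq_rpow_of_pow ht four_ne_zero h2
      (r := 2 + 2 * a) ?_ (by push_cast; ring)⟩)
    rw [cohSnd, add_comm]
    refine norm_add_eq_of_lt (norm_mul_pow_eq ht (norm_theta_pow 2) hs 2 (by push_cast; ring)) ?_
    exact hv.trans (Real.rpow_lt_rpow_of_exponent_lt ht (by linarith))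
  have hf := norm_cohFst_eq_of_lt ht hs hu.le (by linarith) (by linarith)
  rcases le_or_gt a 0 with ha0 | ha0
  · refine .inr (.inr (.inl (cohRegionMid_of_norm ht h1 h2 (a := (6 + a) / 4) (by linarith)
      (by rw [hf]; congr 1; ring) (norm_cohSnd_lt ht hv.le hs.le (by linarith) (by linarith)))))
  · have hu' : ‖u'‖ = ‖θ‖ ^ ((6 + a) / 4) :=
      norm_eq_rpow_of_pow ht four_ne_zero h1 hf (by push_cast; ring)
    have hv' : ‖v'‖ < ‖θ‖ ^ (1 / 2 + 3 * a / 4) :=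
      norm_lt_rpow_of_pow ht four_ne_zero h2 (r := 2 + 3 * a)
        (norm_cohSnd_lt ht hv.le hs.le (by linarith) (by linarith)) (by push_cast; linarith)
    refine .inl ⟨(6 + a) / 4, by linarith, hu', norm_add_lt_of_lt ?_ (norm_sq_lt ht ?_), ?_⟩
    · rw [hu']; exact Real.rpow_lt_rpow_of_exponent_lt ht (by linarith)
    · exact hv'.trans (Real.rpow_lt_rpow_of_exponent_lt ht (by linarith))
    · exact hv'.trans (Real.rpow_lt_rpow_of_exponent_lt ht (by linarith))

/-- Cancellation in `u + v ^ 2` needs `‖u‖ = ‖v‖ ^ 2`. Then `4 * b - 1` is the exponent at which `θ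
^ 6 * (u + v ^ 2)` balances `θ ^ 5 * u ^ 2`. At the balance the first coordinate is uncontrolled,
but `θ ^ 2 * (u + v ^ 2) ^ 2` has exponent `8 * b < b`, so `v` dominates the second one and the
annulus recurs with `b / 4`. This is where `b < 0` is essential. -/
lemma CohRegionAnn.step (ht : 1 < ‖θ‖) (h : CohRegionAnn θ v) (h1 : u' ^ 4 = cohFst θ u v)
    (h2 : v' ^ 4 = cohSnd θ u v) : CohRegion θ u' v' := by
  obtain ⟨b, hb, hb', hv⟩ := h
  have hv2 := norm_sq_eq ht hv
  rcases lt_trichotomy ‖u‖ (‖θ‖ ^ (2 * b)) with hu | hu | hu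
  · have hs : ‖u + v ^ 2‖ = ‖θ‖ ^ (2 * b) := by
      rw [add_comm]; exact norm_add_eq_of_lt hv2 hu
    have hf := norm_cohFst_eq_of_lt ht hs hu.le (by linarith) (by linarith)
    exact .inr (.inr (.inl (cohRegionMid_of_norm ht h1 h2 (a := (3 + b) / 2) (by linarith)
      (by rw [hf]; congr 1; ring) (norm_cohSnd_lt ht hv.le hs.le (by linarith) (by linarith)))))
  · rcases lt_trichotomy ‖u + v ^ 2‖ (‖θ‖ ^ (4 * b - 1)) with hs | hs | hs
    · refine .inr (.inr (.inl (cohRegionMid_of_norm ht h1 h2 (a := (5 + 4 * b) / 4) (by linarith)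
        ?_ (norm_cohSnd_lt ht hv.le hs.le (by linarith) (by linarith)))))
      have : cohFst θ u v = θ ^ 5 * u ^ 2 + (θ ^ 6 * (u + v ^ 2) ^ 1 + θ ^ 2 * u ^ 4) := by
        rw [cohFst]; ring
      rw [this]
      refine norm_add_eq_of_lt (norm_mul_pow_eq ht (norm_theta_pow 5) hu 2 (by push_cast; ring))
        (norm_add_lt_of_lt ?_ ?_)
      · exact norm_mul_pow_lt_of_lt ht (norm_theta_pow 6) hs one_ne_zero (by push_cast; linarith)
      · exact norm_mul_pow_lt ht (norm_theta_pow 2) hu.le 4 (by push_cast; linarith)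
    · refine .inr (.inr (.inr ⟨b / 4, by linarith, by linarith,
        norm_eq_rpow_of_pow ht four_ne_zero h2 (r := b) ?_ (by push_cast; ring)⟩))
      exact norm_add_eq_of_lt hv
        (norm_mul_pow_lt ht (norm_theta_pow 2) hs.le 2 (by push_cast; linarith))
    · obtain ⟨c, hc, hs⟩ := exists_norm_eq_rpow_of_lt ht hs
      have hc' : c ≤ 2 * b := (Real.rpow_le_rpow_left_iff ht).1
        (hs ▸ norm_add_le_of_le hu.le hv2.le)
      have hf := norm_cohFst_eq_of_lt ht hs hu.le (by linarith) (by linarith)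
      exact .inr (.inr (.inl (cohRegionMid_of_norm ht h1 h2 (a := (6 + c) / 4) (by linarith)
        (by rw [hf]; congr 1; ring) (norm_cohSnd_lt ht hv.le hs.le (by linarith) (by linarith)))))
  · obtain ⟨a, ha, hu⟩ := exists_norm_eq_rpow_of_lt ht hu
    exact CohRegionMid.step ht
      ⟨a, by linarith, hu, hv ▸ Real.rpow_lt_rpow_of_exponent_lt ht (by linarith)⟩ h1 h2

lemma CohRegion.step (ht : 1 < ‖θ‖) (h : CohRegion θ u v) (h1 : u' ^ 4 = cohFst θ u v)
    (h2 : v' ^ 4 = cohSnd θ u v) : CohRegion θ u' v' := by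
  rcases h with h | h | h | h
  · exact .inl (h.step ht h1 h2)
  · exact h.step ht h1 h2
  · exact h.step ht h1 h2
  · exact h.step ht h1 h2

lemma CohBall.norm_add_sq_lt (ht : 1 < ‖θ‖) (h : CohBall θ u v) :
    ‖u + v ^ 2‖ < ‖θ‖ ^ (-(4 / 3) : ℝ) :=
  norm_add_lt_of_lt h.1 (norm_sq_lt ht (by convert h.2 using 2; norm_num))

/-- The exponent of `v'` stays below `-(1 / 6)`, so `v'` cannot jump over the annulus; if `v'` stays
in the ball, an escaping `u'` dominates `v' ^ 2`. -/
lemma CohBall.step (ht : 1 < ‖θ‖) (h : CohBall θ u v) (h2 : v' ^ 4 = cohSnd θ u v) :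
    CohBall θ u' v' ∨ CohRegion θ u' v' := by
  have hv : ‖v'‖ < ‖θ‖ ^ (-(1 / 6) : ℝ) := by
    refine norm_lt_rpow_of_pow ht four_ne_zero h2 (r := -(2 / 3)) ?_ (by norm_num)
    exact norm_add_lt_of_lt h.2 (norm_mul_pow_lt_of_lt ht (norm_theta_pow 2)
      (h.norm_add_sq_lt ht) two_ne_zero (by norm_num))
  rcases lt_or_ge ‖v'‖ (‖θ‖ ^ (-(2 / 3) : ℝ)) with hv' | hv'
  · rcases lt_or_ge ‖u'‖ (‖θ‖ ^ (-(4 / 3) : ℝ)) with hu' | hu'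
    · exact .inl ⟨hu', hv'⟩
    · obtain ⟨a, ha, hu⟩ := exists_norm_eq_rpow_of_le ht hu'
      exact .inr (.inr (.inr (.inl ⟨a, ha, hu,
        hv'.trans_le (Real.rpow_le_rpow_of_exponent_le ht.le (by linarith))⟩)))
  · obtain ⟨b, hb, hb'⟩ := exists_norm_eq_rpow_of_le ht hv'
    have : b < -(1 / 6) := (Real.rpow_lt_rpow_left_iff ht).1 (hb' ▸ hv)
    exact .inr (.inr (.inr (.inr ⟨b, hb, by linarith, hb'⟩)))

/-- If `u ≠ 0` has exponent `a`, the first equation gives `u + v ^ 2` exponent at most `2 * a - 1`,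
the second gives `v` at most `4 * a`, and `u = (u + v ^ 2) - v ^ 2` is smaller than itself. If `u =
0`, then `v = -θ ^ 2 * v ^ 4`, whose nonzero solutions have exponent `-(2 / 3)`, on the boundary of
the ball. -/
lemma CohBall.eq_zero (ht : 1 < ‖θ‖) (h : CohBall θ u v) (h1 : cohFst θ u v = 0)
    (h2 : cohSnd θ u v = 0) : u = 0 ∧ v = 0 := by
  have hθ : θ ≠ 0 := norm_pos_iff.1 (by linarith)
  have hs := h.norm_add_sq_lt ht
  have hv : v = -(θ ^ 2 * (u + v ^ 2) ^ 2) := by rw [cohSnd] at h2; linear_combination h2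
  suffices hu : u = 0 by
    rw [hu] at hv h
    refine ⟨hu, ?_⟩
    by_contra hv0
    obtain ⟨b, hb⟩ := exists_norm_eq_rpow ht hv0
    have hb1 : b < -(2 / 3) := (Real.rpow_lt_rpow_left_iff ht).1 (hb ▸ h.2)
    have hb2 : ‖v‖ = ‖θ‖ ^ (2 + 4 * b) := by
      have : v = -(θ ^ 2 * v ^ 4) := by linear_combination hv
      rw [this, norm_neg]
      exact norm_mul_pow_eq ht (norm_theta_pow 2) hb 4 (by push_cast; ring)
    have : ‖v‖ < ‖v‖ := by
      conv_lhs => rw [hb2]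
      rw [hb]
      exact Real.rpow_lt_rpow_of_exponent_lt ht (by linarith)
    exact this.false
  by_contra hu0
  obtain ⟨a, ha⟩ := exists_norm_eq_rpow ht hu0
  have ha1 : a < -(4 / 3) := (Real.rpow_lt_rpow_left_iff ht).1 (ha ▸ h.1)
  have hs2 : ‖u + v ^ 2‖ ≤ ‖θ‖ ^ (2 * a - 1) := by
    have : u + v ^ 2 = -(θ⁻¹ ^ 1 * u ^ 2 + θ⁻¹ ^ 4 * u ^ 4) := by
      rw [cohFst] at h1
      apply mul_left_cancel₀ (pow_ne_zero 6 hθ)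
      have e : θ ^ 6 * -(θ⁻¹ ^ 1 * u ^ 2 + θ⁻¹ ^ 4 * u ^ 4) =
        -((θ * θ⁻¹) * θ ^ 5 * u ^ 2 + (θ * θ⁻¹) ^ 4 * θ ^ 2 * u ^ 4) := by ring
      rw [e, mul_inv_cancel₀ hθ]
      linear_combination h1
    rw [this, norm_neg]
    refine norm_add_le_of_le ?_ ?_
    · exact norm_mul_pow_le ht (norm_theta_inv_pow 1) ha.le 2 (by push_cast; linarith)
    · exact norm_mul_pow_le ht (norm_theta_inv_pow 4) ha.le 4 (by push_cast; linarith)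
  have hv2 : ‖v‖ ≤ ‖θ‖ ^ (4 * a) := by
    rw [hv, norm_neg]
    exact norm_mul_pow_le ht (norm_theta_pow 2) hs2 2 (by push_cast; linarith)
  have : ‖u‖ < ‖θ‖ ^ a := by
    have e : u = (u + v ^ 2) + (-1) * v ^ 2 := by ring
    rw [e]
    refine norm_add_lt_of_lt (hs2.trans_lt (Real.rpow_lt_rpow_of_exponent_lt ht (by linarith))) ?_
    exact norm_mul_pow_lt ht (k := 0) (by rw [norm_neg, norm_one, Real.rpow_zero]) hv2 2
      (by push_cast; linarith)
  exact (ha ▸ this).false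

/-- The sequences of the coefficients of the `τ`-invariants. -/
structure IsCohSeq (θ : K) (u v : ℕ → K) : Prop where
  fst_zero : cohFst θ (u 0) (v 0) = 0
  snd_zero : cohSnd θ (u 0) (v 0) = 0
  fst_succ n : u n ^ 4 = cohFst θ (u (n + 1)) (v (n + 1))
  snd_succ n : v n ^ 4 = cohSnd θ (u (n + 1)) (v (n + 1))

variable {u v : ℕ → K}

/-- Continued below index `0` by the point `(0, 0)`, the sequence would pass from a good term to
`0`, which is not good. -/
lemma IsCohSeq.not_good (h : IsCohSeq θ u v) (ht : 1 < ‖θ‖) (n : ℕ) :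
    ¬ ((CohBall θ (u n) (v n) ∧ ¬ (u n = 0 ∧ v n = 0)) ∨ CohRegion θ (u n) (v n)) := by
  induction n with
  | zero =>
    rintro (⟨hb, h0⟩ | hr)
    · exact h0 (hb.eq_zero ht h.fst_zero h.snd_zero)
    · refine not_cohRegion_zero ht (hr.step ht ?_ ?_)
      · rw [h.fst_zero, zero_pow four_ne_zero]
      · rw [h.snd_zero, zero_pow four_ne_zero]
  | succ n ih =>
    rintro (⟨hb, h0⟩ | hr)
    · rcases hb.step ht (h.snd_succ n) (u' := u n) with hb' | hr
      · refine ih (.inl ⟨hb', fun h0' ↦ h0 (hb.eq_zero ht ?_ ?_)⟩)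
        · rw [← h.fst_succ, h0'.1, zero_pow four_ne_zero]
        · rw [← h.snd_succ, h0'.2, zero_pow four_ne_zero]
      · exact ih (.inr hr)
    · exact ih (.inr (hr.step ht (h.fst_succ n) (h.snd_succ n)))

lemma IsCohSeq.eq_zero (h : IsCohSeq θ u v) (ht : 1 < ‖θ‖)
    (hu : Filter.Tendsto u Filter.atTop (nhds 0)) (hv : Filter.Tendsto v Filter.atTop (nhds 0))
    (n : ℕ) : u n = 0 ∧ v n = 0 := by
  have hp (r : ℝ) : 0 < ‖θ‖ ^ r := Real.rpow_pos_of_pos (by linarith) r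
  have hball : ∀ᶠ m in Filter.atTop, CohBall θ (u m) (v m) := by
    have h1 := hu.norm.eventually_lt_const (by rw [norm_zero]; exact hp (-(4 / 3)))
    have h2 := hv.norm.eventually_lt_const (by rw [norm_zero]; exact hp (-(2 / 3)))
    exact h1.and h2
  obtain ⟨N, hN⟩ := Filter.eventually_atTop.1 hball
  have hlarge (m : ℕ) (hm : N ≤ m) : u m = 0 ∧ v m = 0 := by
    by_contra h0
    exact h.not_good ht m (.inl ⟨hN m hm, h0⟩)
  -- A zero term makes the preceding one zero. The subtraction is truncated, so at `N - k = 0` the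
  -- claim only repeats itself.
  have hdown (k : ℕ) : u (N - k) = 0 ∧ v (N - k) = 0 := by
    induction k with
    | zero => exact hlarge N le_rfl
    | succ k ih =>
      rcases Nat.eq_zero_or_pos (N - k) with hk | hk
      · rwa [Nat.sub_succ, hk, Nat.pred_zero, ← hk]
      · have e : N - k = N - (k + 1) + 1 := by omega
        rw [e] at ih
        have h1 := h.fst_succ (N - (k + 1))
        have h2 := h.snd_succ (N - (k + 1))
        rw [ih.1, ih.2] at h1 h2
        rw [cohFst] at h1
        rw [cohSnd] at h2
        constructor <;> apply eq_zero_of_pow_eq_zero (n := 4)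
        · rw [h1]; ring
        · rw [h2]; ring
  rcases le_total N n with hn | hn
  · exact hlarge n hn
  · simpa [Nat.sub_sub_self hn] using hdown (N - n)

end Cohomology

/-! ### Division by `T` through a contraction -/

section Existence

variable {K : Type*} [NormedField K] [IsUltrametricDist K] {θ : K}

/-- In characteristic 2 the difference of squares or fourth powers is a power of `x - y`, which
gains a factor `r`. -/
lemma norm_mul_pow_sub_pow_le {c x y : K} {r : ℝ} (hr : r ≤ 1) (hc : ‖c‖ ≤ 1) (hx : ‖x‖ ≤ r)
    (hy : ‖y‖ ≤ r) (h2 : (2 : K) = 0) {n : ℕ} (hn : n = 2 ∨ n = 4) :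
    ‖c * (x ^ n - y ^ n)‖ ≤ r * ‖x - y‖ := by
  have hr0 : 0 ≤ r := (norm_nonneg x).trans hx
  have hxy : ‖x - y‖ ≤ r := by
    rw [sub_eq_add_neg]; exact norm_add_le_of_le hx (by rwa [norm_neg])
  have hs : ‖x - y‖ ^ 2 ≤ r * ‖x - y‖ := by
    rw [sq]; gcongr
  rw [norm_mul]
  refine (mul_le_of_le_one_left (norm_nonneg _) hc).trans ?_
  rcases hn with rfl | rfl
  · have : x ^ 2 - y ^ 2 = (x - y) ^ 2 := by linear_combination (x * y - y ^ 2) * h2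
    rwa [this, norm_pow]
  · have : x ^ 4 - y ^ 4 = (x - y) ^ 4 := by
      linear_combination (2 * x ^ 3 * y - 3 * x ^ 2 * y ^ 2 + 2 * x * y ^ 3 - y ^ 4) * h2
    rw [this, norm_pow]
    exact (pow_le_pow_of_le_one (norm_nonneg _) (hxy.trans hr) (by norm_num)).trans hs

/-- Small right-hand sides have small preimages under the action of `T`. -/
lemma exists_hom_eq [CompleteSpace K] (ht : 1 < ‖θ‖) (h2 : (2 : K) = 0) {r : ℝ} (hr : r < 1)
    {c d : K} (hc : ‖c‖ ≤ r) (hd : ‖d‖ ≤ r) :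
    ∃ x w, homFst θ x w = θ * c ∧ homSnd θ x w = θ * d ∧ ‖x‖ ≤ r ∧ ‖w‖ ≤ r := by
  have hθ : θ ≠ 0 := norm_pos_iff.1 (by linarith)
  have hr0 : 0 ≤ r := (norm_nonneg c).trans hc
  have hi : ‖θ⁻¹‖ ≤ 1 := by rw [norm_inv]; exact inv_le_one_of_one_le₀ ht.le
  have hi10 : ‖θ⁻¹ ^ 10‖ ≤ 1 := by rw [norm_pow]; exact pow_le_one₀ (norm_nonneg _) hi
  -- The equations divided by `θ` and solved for their linear terms.
  let f : K × K → K × K := fun p ↦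
    (c - (1 * p.1 ^ 2 + θ⁻¹ * p.2 ^ 2 + θ⁻¹ * p.1 ^ 4), d - (1 * p.1 ^ 2 + θ⁻¹ ^ 10 * p.2 ^ 4))
  let s : Set (K × K) := Metric.closedBall 0 r
  have hs {p : K × K} : p ∈ s ↔ ‖p.1‖ ≤ r ∧ ‖p.2‖ ≤ r := by
    rw [mem_closedBall_zero_iff, Prod.norm_def, max_le_iff]
  have key {k z : K} {n : ℕ} (hk : ‖k‖ ≤ 1) (hn : n ≠ 0) (hz : ‖z‖ ≤ r) : ‖k * z ^ n‖ ≤ r := by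
    rw [norm_mul, norm_pow]
    calc ‖k‖ * ‖z‖ ^ n ≤ 1 * r ^ n := by gcongr
      _ ≤ r := by rw [one_mul]; exact pow_le_of_le_one hr0 hr.le hn
  have hsub {a b : K} {R : ℝ} (ha : ‖a‖ ≤ R) (hb : ‖b‖ ≤ R) : ‖a - b‖ ≤ R := by
    rw [sub_eq_add_neg]; exact norm_add_le_of_le ha (by rwa [norm_neg])
  have hf : Set.MapsTo f s s := by
    intro p hp
    obtain ⟨h1, h2⟩ := hs.1 hp
    refine hs.2 ⟨hsub hc (norm_add_le_of_le (norm_add_le_of_le ?_ ?_) ?_),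
      hsub hd (norm_add_le_of_le ?_ ?_)⟩
    · exact key norm_one.le two_ne_zero h1
    · exact key hi two_ne_zero h2
    · exact key hi four_ne_zero h1
    · exact key norm_one.le two_ne_zero h1
    · exact key hi10 four_ne_zero h2
  have hcontr : ContractingWith ⟨r, hr0⟩ (hf.restrict f s s) := by
    refine ⟨NNReal.coe_lt_coe.1 hr, LipschitzWith.of_dist_le_mul ?_⟩
    rintro ⟨p, hp⟩ ⟨p', hp'⟩
    obtain ⟨h3, h4⟩ := hs.1 hp
    obtain ⟨h3', h4'⟩ := hs.1 hp'
    rw [Subtype.dist_eq, Subtype.dist_eq, dist_eq_norm, dist_eq_norm]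
    change ‖f p - f p'‖ ≤ r * ‖p - p'‖
    have b1 : ‖p'.1 - p.1‖ ≤ ‖p - p'‖ := by
      rw [← norm_neg, neg_sub]; exact norm_fst_le (p - p')
    have b2 : ‖p'.2 - p.2‖ ≤ ‖p - p'‖ := by
      rw [← norm_neg, neg_sub]; exact norm_snd_le (p - p')
    have m1 := mul_le_mul_of_nonneg_left b1 hr0
    have m2 := mul_le_mul_of_nonneg_left b2 hr0
    rw [Prod.norm_def, max_le_iff]
    constructor
    · have : (f p - f p').1 = 1 * (p'.1 ^ 2 - p.1 ^ 2) + θ⁻¹ * (p'.2 ^ 2 - p.2 ^ 2) +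
          θ⁻¹ * (p'.1 ^ 4 - p.1 ^ 4) := by
        simp only [f, Prod.fst_sub]; ring
      rw [this]
      refine norm_add_le_of_le (norm_add_le_of_le ?_ ?_) ?_
      · exact (norm_mul_pow_sub_pow_le hr.le norm_one.le h3' h3 h2 (.inl rfl)).trans m1
      · exact (norm_mul_pow_sub_pow_le hr.le hi h4' h4 h2 (.inl rfl)).trans m2
      · exact (norm_mul_pow_sub_pow_le hr.le hi h3' h3 h2 (.inr rfl)).trans m1
    · have : (f p - f p').2 = 1 * (p'.1 ^ 2 - p.1 ^ 2) + θ⁻¹ ^ 10 * (p'.2 ^ 4 - p.2 ^ 4) := by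
        simp only [f, Prod.snd_sub]; ring
      rw [this]
      refine norm_add_le_of_le ?_ ?_
      · exact (norm_mul_pow_sub_pow_le hr.le norm_one.le h3' h3 h2 (.inl rfl)).trans m1
      · exact (norm_mul_pow_sub_pow_le hr.le hi10 h4' h4 h2 (.inr rfl)).trans m2
  obtain ⟨p, hp, hfix, -⟩ := ContractingWith.exists_fixedPoint'
    (Metric.isClosed_closedBall.isComplete) hf hcontr (x := 0) (Metric.mem_closedBall_self hr0)
    (edist_ne_top _ _)
  obtain ⟨h3, h4⟩ := hs.1 hp
  have e1 : c - (1 * p.1 ^ 2 + θ⁻¹ * p.2 ^ 2 + θ⁻¹ * p.1 ^ 4) = p.1 := congrArg Prod.fst hfix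
  have e2 : d - (1 * p.1 ^ 2 + θ⁻¹ ^ 10 * p.2 ^ 4) = p.2 := congrArg Prod.snd hfix
  have hθi : θ * θ⁻¹ = 1 := mul_inv_cancel₀ hθ
  refine ⟨p.1, p.2, ?_, ?_, h3, h4⟩
  · rw [homFst]
    linear_combination (-θ) * e1 - (p.2 ^ 2 + p.1 ^ 4) * hθi
  · rw [homSnd]
    linear_combination (-θ) * e2 - (θ⁻¹ ^ 9 * p.2 ^ 4) * hθi

/-- A sequence that generates all the sequences tending to `0`. -/
lemma exists_isHomSeq [CompleteSpace K] (ht : 1 < ‖θ‖) (h2 : (2 : K) = 0) :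
    ∃ x w : ℕ → K, IsHomSeq θ x w ∧ ‖1 + x 0‖ < 1 ∧ ‖1 + w 0‖ < 1 ∧
      ∀ n, ‖x n‖ ≤ ‖θ‖⁻¹ ^ n ∧ ‖w n‖ ≤ ‖θ‖⁻¹ ^ n := by
  have hθ : θ ≠ 0 := norm_pos_iff.1 (by linarith)
  have hi : ‖θ‖⁻¹ < 1 := inv_lt_one_of_one_lt₀ ht
  have hi0 : 0 ≤ ‖θ‖⁻¹ := inv_nonneg.2 (norm_nonneg θ)
  -- In characteristic 2, `T (1, 1) = (0, θ⁻⁹)`, so the correction of `(1, 1)` to a torsion point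
  -- must have image `θ (0, θ⁻¹⁰)`.
  obtain ⟨x₀, w₀, hx₀, hw₀, hxn, hwn⟩ := exists_hom_eq ht h2 hi (c := 0) (d := θ⁻¹ ^ 10)
    (by rw [norm_zero]; exact hi0)
    (by rw [norm_pow, norm_inv]; exact pow_le_of_le_one hi0 hi.le (by norm_num))
  -- Writing the right-hand side as `θ (θ⁻¹ z)` gains a factor `‖θ‖⁻¹` at each division.
  have step (n : ℕ) (p : {p : K × K // ‖p.1‖ ≤ ‖θ‖⁻¹ ^ n ∧ ‖p.2‖ ≤ ‖θ‖⁻¹ ^ n}) :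
      ∃ p' : {p : K × K // ‖p.1‖ ≤ ‖θ‖⁻¹ ^ (n + 1) ∧ ‖p.2‖ ≤ ‖θ‖⁻¹ ^ (n + 1)},
        homFst θ p'.1.1 p'.1.2 = p.1.1 ∧ homSnd θ p'.1.1 p'.1.2 = p.1.2 := by
    have hm {z : K} (hz : ‖z‖ ≤ ‖θ‖⁻¹ ^ n) : ‖θ⁻¹ * z‖ ≤ ‖θ‖⁻¹ ^ (n + 1) := by
      rw [norm_mul, norm_inv, pow_succ']; gcongr
    obtain ⟨x, w, hx, hw, hx', hw'⟩ := exists_hom_eq ht h2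
      (pow_lt_one₀ hi0 hi n.succ_ne_zero) (hm p.2.1) (hm p.2.2)
    rw [mul_inv_cancel_left₀ hθ] at hx hw
    exact ⟨⟨(x, w), hx', hw'⟩, hx, hw⟩
  choose g hg1 hg2 using step
  have hle {z : K} (hz : ‖z‖ ≤ ‖θ‖⁻¹) : ‖1 + z‖ ≤ ‖θ‖⁻¹ ^ 0 := by
    rw [pow_zero]; exact norm_add_le_of_le norm_one.le (hz.trans hi.le)
  let p (n : ℕ) : {p : K × K // ‖p.1‖ ≤ ‖θ‖⁻¹ ^ n ∧ ‖p.2‖ ≤ ‖θ‖⁻¹ ^ n} :=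
    Nat.rec ⟨(1 + x₀, 1 + w₀), hle hxn, hle hwn⟩ g n
  have hlt {z : K} (hz : ‖z‖ ≤ ‖θ‖⁻¹) : ‖1 + (1 + z)‖ < 1 := by
    have : 1 + (1 + z) = z := by linear_combination h2
    rw [this]
    exact hz.trans_lt hi
  refine ⟨fun n ↦ (p n).1.1, fun n ↦ (p n).1.2, ⟨?_, ?_, fun n ↦ hg1 n (p n), fun n ↦ hg2 n (p n)⟩,
    hlt hxn, hlt hwn, fun n ↦ (p n).2⟩
  · change homFst θ (1 + x₀) (1 + w₀) = 0
    rw [homFst] at hx₀ ⊢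
    linear_combination hx₀ + (θ + 1 + θ * x₀ + w₀ + 2 * x₀ + 3 * x₀ ^ 2 + 2 * x₀ ^ 3) * h2
  · change homSnd θ (1 + x₀) (1 + w₀) = 0
    have hθi : θ * θ⁻¹ = 1 := mul_inv_cancel₀ hθ
    rw [homSnd] at hw₀ ⊢
    linear_combination hw₀ + θ⁻¹ ^ 9 * hθi +
      (θ + θ * x₀ + θ⁻¹ ^ 9 * (1 + 2 * w₀ + 3 * w₀ ^ 2 + 2 * w₀ ^ 3)) * h2

end Existence

end AndersonMotive

noncomputable section

open Polynomial TensorProduct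

namespace AndersonMotive

/-! ### The universal property of the motive -/

section Lift

variable {F : Type*} [Field F] [Fintype F] {n : ℕ} {A : Matrix (Fin n) (Fin n) (CInf F)}

lemma rowTau_single (i : Fin n) (p : SkewRing F) :
    rowTau (Pi.single i p) = Pi.single i (SkewPolynomial.X * p) :=
  (Pi.single_op (fun _ p ↦ (SkewPolynomial.X : SkewRing F) * p) (fun _ ↦ mul_zero _) i p).symm

lemma row_induction {P : (Fin n → SkewRing F) → Prop} (single : ∀ i, P (Pi.single i 1))
    (zero : P 0) (add : ∀ v w, P v → P w → P (v + w)) (smul : ∀ (c : CInf F) v, P v → P (c • v))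
    (tau : ∀ v, P v → P (rowTau v)) (v : Fin n → SkewRing F) : P v := by
  have hpow (i : Fin n) (k : ℕ) : P (Pi.single i (SkewPolynomial.X ^ k)) := by
    induction k with
    | zero => rw [pow_zero]; exact single i
    | succ k ih => rw [pow_succ', ← rowTau_single]; exact tau _ ih
  rw [← Finset.univ_sum_single v]
  refine Finset.sum_induction _ P add zero fun i _ ↦ ?_
  generalize v i = p
  induction p using SkewPolynomial.induction with
  | h0 => rwa [Pi.single_zero]
  | ha k r q _ _ hq =>
    rw [Pi.single_add]
    refine add _ _ ?_ hq
    rw [← SkewPolynomial.smul_X_eq_monomial, Pi.single_smul]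
    exact smul _ _ (hpow i k)

lemma tAction_single (i : Fin n) :
    tAction A 0 (Pi.single i 1) = CInf.theta F • (Pi.single i 1 : Fin n → SkewRing F) +
      ∑ j, A i j • rowTau (Pi.single j 1 : Fin n → SkewRing F) +
        rowTau (rowTau (Pi.single i 1)) := by
  have hC (c : CInf F) : SkewPolynomial.C c = c • (1 : SkewRing F) := by
    rw [← pow_zero SkewPolynomial.X, SkewPolynomial.smul_X_eq_monomial,
      SkewPolynomial.monomial_zero_left]
  change Matrix.vecMul (Pi.single i 1) (tMatrix A 0) = _
  rw [Matrix.single_one_vecMul]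
  ext1 j
  simp only [rowTau_single, mul_one, hC, Pi.add_apply, Pi.smul_apply, Finset.sum_apply, tMatrix,
    add_zero, Matrix.row_apply, Matrix.add_apply, Matrix.map_apply, Matrix.scalar_apply,
    Matrix.diagonal_apply]
  rw [Finset.sum_eq_single j (fun k _ hk ↦ by rw [Pi.single_eq_of_ne hk.symm, smul_zero])
    (fun h ↦ (h (Finset.mem_univ j)).elim), Pi.single_eq_same]
  by_cases h : i = j
  · subst h
    simp [sq]
  · simp [h]

variable (A) in
/-- The basis elements `eᵢ` of the motive. -/
def gen (i : Fin n) : Motive A 0 := Module.AEval'.of (tAction A 0) (Pi.single i 1)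

lemma X_smul_gen (i : Fin n) :
    (X : (CInf F)[X]) • gen A i = CInf.theta F • gen A i +
      ∑ j, A i j • motiveTau A 0 (gen A j) + motiveTau A 0 (motiveTau A 0 (gen A i)) := by
  rw [gen, Module.AEval'.X_smul_of, tAction_single, map_add, map_add, map_smul, map_sum]
  simp only [map_smul]
  rfl

variable {W : Type*} [AddCommGroup W] [Module (CInf F)[X] W] (τ : W →ₛₗ[polyFrob F] W)

lemma map_frob_C_smul (c : CInf F) (m : W) : τ (C c • m) = C (frob F c) • τ m := by
  rw [map_smulₛₗ]
  simp [polyFrob]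

lemma map_frob_X_smul (m : W) : τ ((X : (CInf F)[X]) • m) = (X : (CInf F)[X]) • τ m := by
  rw [map_smulₛₗ]
  simp [polyFrob]

variable {τ} in
-- The `gen A i` generate the motive under `C∞` and `τ` alone.
lemma motive_hom_ext {φ ψ : Motive A 0 →ₗ[(CInf F)[X]] W}
    (hφ : ∀ m, φ (motiveTau A 0 m) = τ (φ m)) (hψ : ∀ m, ψ (motiveTau A 0 m) = τ (ψ m))
    (h : ∀ i, φ (gen A i) = ψ (gen A i)) : φ = ψ := by
  ext m
  obtain ⟨v, rfl⟩ := (Module.AEval'.of (tAction A 0)).surjective m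
  induction v using row_induction with
  | single i => exact h i
  | zero => simp
  | add v w hv hw => rw [map_add, map_add, map_add, hv, hw]
  | smul c v hv =>
    rw [map_smul, ← Module.AEval.C_smul, map_smul, map_smul, hv]
  | tau v hv =>
    have h1 := hφ (Module.AEval'.of (tAction A 0) v)
    have h2 := hψ (Module.AEval'.of (tAction A 0) v)
    rw [hv, ← h2] at h1
    exact h1

variable [Module (CInf F) W]

/-- The evaluation `∑ cₖ τᵏ ↦ ∑ cₖ τᵏ(w)` of skew polynomials. -/
def skewEval (w : W) : SkewRing F →ₗ[CInf F] W :=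
  Finsupp.linearCombination (CInf F) (fun k : Multiplicative ℕ ↦ τ^[k.toAdd] w) ∘ₗ
    (SkewMonoidAlgebra.coeffLinearEquiv : SkewRing F ≃ₗ[CInf F] _).toLinearMap

lemma skewEval_monomial (w : W) (k : ℕ) (c : CInf F) :
    skewEval τ w (SkewPolynomial.monomial k c) = c • τ^[k] w :=
  Finsupp.linearCombination_single (CInf F) c _

/-- The evaluation `∑ pᵢ eᵢ ↦ ∑ pᵢ(wᵢ)` of rows of skew polynomials. -/
def rowEval (w : Fin n → W) : (Fin n → SkewRing F) →ₗ[CInf F] W :=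
  ∑ i, (skewEval τ (w i)).comp (LinearMap.proj i)

lemma rowEval_single (w : Fin n → W) (i : Fin n) : rowEval τ w (Pi.single i 1) = w i := by
  simp only [rowEval, LinearMap.sum_apply, LinearMap.comp_apply, LinearMap.proj_apply]
  rw [Finset.sum_eq_single i (fun j _ hj ↦ by rw [Pi.single_eq_of_ne hj, map_zero])
    (fun h ↦ (h (Finset.mem_univ i)).elim), Pi.single_eq_same, ← SkewPolynomial.monomial_zero_one,
    skewEval_monomial, one_smul]
  rfl

variable [IsScalarTower (CInf F) (CInf F)[X] W]

lemma smul_eq_C_smul (c : CInf F) (m : W) : c • m = (C c : (CInf F)[X]) • m := by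
  rw [← smul_one_smul (CInf F)[X] c m, smul_eq_C_mul, mul_one]

lemma map_frob_smul (c : CInf F) (m : W) : τ (c • m) = frob F c • τ m := by
  rw [smul_eq_C_smul, smul_eq_C_smul, map_frob_C_smul]

lemma skewEval_X_mul (w : W) (p : SkewRing F) :
    skewEval τ w (SkewPolynomial.X * p) = τ (skewEval τ w p) := by
  induction p using SkewPolynomial.induction with
  | h0 => simp
  | ha k r q _ _ hq =>
    rw [mul_add, map_add, map_add, map_add, hq, SkewPolynomial.X_mul_monomial, skewEval_monomial,
      skewEval_monomial, map_frob_smul, Function.iterate_succ_apply']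
    rfl

lemma rowEval_rowTau (w : Fin n → W) (v : Fin n → SkewRing F) :
    rowEval τ w (rowTau v) = τ (rowEval τ w v) := by
  simp only [rowEval, LinearMap.sum_apply, LinearMap.comp_apply, LinearMap.proj_apply, map_sum]
  exact Finset.sum_congr rfl fun i _ ↦ skewEval_X_mul τ (w i) (v i)

variable {τ} in
-- The relation on the generators spreads to all rows because the action of `T` commutes with
-- scalars and with `τ`.
lemma rowEval_tAction {w : Fin n → W}
    (h : ∀ i, (X : (CInf F)[X]) • w i =
      CInf.theta F • w i + ∑ j, A i j • τ (w j) + τ (τ (w i))) (v : Fin n → SkewRing F) :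
    rowEval τ w (tAction A 0 v) = (X : (CInf F)[X]) • rowEval τ w v := by
  induction v using row_induction with
  | single i =>
    rw [tAction_single, rowEval_single, h]
    simp only [map_add, map_smul, map_sum, rowEval_rowTau, rowEval_single]
  | zero => simp
  | add v w hv hw => simp only [map_add, smul_add, hv, hw]
  | smul c v hv =>
    rw [map_smul, map_smul, map_smul, hv, smul_eq_C_smul, smul_eq_C_smul c,
      smul_comm]
  | tau v hv => rw [← rowTau_tAction, rowEval_rowTau, hv, rowEval_rowTau, map_frob_X_smul]

/-- The universal property of the motive. -/
lemma exists_motive_hom {w : Fin n → W}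
    (h : ∀ i, (X : (CInf F)[X]) • w i =
      CInf.theta F • w i + ∑ j, A i j • τ (w j) + τ (τ (w i))) :
    ∃ φ : Motive A 0 →ₗ[(CInf F)[X]] W,
      (∀ m, φ (motiveTau A 0 m) = τ (φ m)) ∧ ∀ i, φ (gen A i) = w i := by
  refine ⟨LinearMap.ofAEval (tAction A 0) (rowEval τ w) (rowEval_tAction h), fun m ↦ ?_, fun i ↦ ?_⟩
  · exact rowEval_rowTau τ w _
  · exact rowEval_single τ w i

end Lift

/-! ### The basis `eᵢ, τ eᵢ` over `C∞[T]` -/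

section Basis

variable {F : Type*} [Field F] [Fintype F] {n : ℕ} (A : Matrix (Fin n) (Fin n) (CInf F))

/-- The action of `τ` in the coordinates of the basis `e₁, …, eₙ, τ e₁, …, τ eₙ`. -/
def coordTau : ((Fin n → (CInf F)[X]) × (Fin n → (CInf F)[X])) →ₛₗ[polyFrob F]
    ((Fin n → (CInf F)[X]) × (Fin n → (CInf F)[X])) where
  toFun p := (fun i ↦ (X - C (CInf.theta F)) * polyFrob F (p.2 i),
    fun j ↦ polyFrob F (p.1 j) - ∑ i, polyFrob F (p.2 i) * C (A i j))
  map_add' p q := by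
    ext1 <;> funext i
    · simp [mul_add]
    · simp only [Prod.fst_add, Prod.snd_add, Pi.add_apply, map_add, add_mul,
        Finset.sum_add_distrib]
      ring
  map_smul' c p := by
    ext1 <;> funext i
    · simp only [Prod.smul_snd, Prod.smul_fst, Pi.smul_apply, smul_eq_mul, map_mul]
      ring
    · simp only [Prod.smul_snd, Prod.smul_fst, Pi.smul_apply, smul_eq_mul, map_mul, mul_sub,
        Finset.mul_sum, mul_assoc]

lemma coordTau_apply (p : (Fin n → (CInf F)[X]) × (Fin n → (CInf F)[X])) :
    coordTau A p = (fun i ↦ (X - C (CInf.theta F)) * polyFrob F (p.2 i),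
      fun j ↦ polyFrob F (p.1 j) - ∑ i, polyFrob F (p.2 i) * C (A i j)) := rfl

/-- The linear map that the coordinates invert. -/
def ofCoord : ((Fin n → (CInf F)[X]) × (Fin n → (CInf F)[X])) →ₗ[(CInf F)[X]] Motive A 0 :=
  (Fintype.linearCombination (CInf F)[X] (gen A)).coprod
    (Fintype.linearCombination (CInf F)[X] (fun i ↦ motiveTau A 0 (gen A i)))

lemma ofCoord_apply (p : (Fin n → (CInf F)[X]) × (Fin n → (CInf F)[X])) :
    ofCoord A p = ∑ i, p.1 i • gen A i + ∑ i, p.2 i • motiveTau A 0 (gen A i) := rfl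

/-- The defining relation of `T`, solved for `τ² eᵢ`: over `C∞[T]` no higher power of `τ` is needed.
-/
lemma tau_tau_gen (i : Fin n) :
    motiveTau A 0 (motiveTau A 0 (gen A i)) =
      (X - C (CInf.theta F)) • gen A i - ∑ j, C (A i j) • motiveTau A 0 (gen A j) := by
  have h := X_smul_gen (A := A) i
  simp only [← Module.AEval.C_smul] at h
  rw [sub_smul, h]
  abel

lemma ofCoord_coordTau (p : (Fin n → (CInf F)[X]) × (Fin n → (CInf F)[X])) :
    ofCoord A (coordTau A p) = motiveTau A 0 (ofCoord A p) := by
  rw [ofCoord_apply, ofCoord_apply, map_add, map_sum, map_sum, coordTau_apply]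
  simp only [map_smulₛₗ, tau_tau_gen, sub_smul, smul_sub, Finset.sum_sub_distrib, Finset.sum_smul,
    Finset.smul_sum, mul_smul, sub_mul]
  rw [Finset.sum_comm]
  simp only [smul_comm (polyFrob F _) X, smul_comm (polyFrob F _) (C (CInf.theta F))]
  abel

lemma coordTau_single (i : Fin n) :
    coordTau A (Pi.single i 1, 0) = (0, Pi.single i 1) := by
  rw [coordTau_apply]
  ext1 <;> funext j
  · simp
  · by_cases h : j = i
    · subst h; simp
    · simp [Pi.single_eq_of_ne h]

lemma coordTau_coordTau_single (i : Fin n) :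
    coordTau A (coordTau A (Pi.single i 1, 0)) =
      ((X - C (CInf.theta F)) • Pi.single i 1, - fun j ↦ C (A i j)) := by
  have hs (j : Fin n) : polyFrob F ((Pi.single i 1 : Fin n → (CInf F)[X]) j) =
      (Pi.single i 1 : Fin n → (CInf F)[X]) j := by
    by_cases h : j = i
    · subst h; simp
    · simp [Pi.single_eq_of_ne h]
  rw [coordTau_single, coordTau_apply]
  simp only [hs]
  ext1 <;> funext j
  · simp
  · simp [Pi.single_apply]

lemma X_smul_single (i : Fin n) :
    (X : (CInf F)[X]) • ((Pi.single i 1, 0) : (Fin n → (CInf F)[X]) × (Fin n → (CInf F)[X])) =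
      CInf.theta F • (Pi.single i 1, 0) + ∑ j, A i j • coordTau A (Pi.single j 1, 0) +
        coordTau A (coordTau A (Pi.single i 1, 0)) := by
  rw [coordTau_coordTau_single]
  simp only [coordTau_single]
  ext1
  · simp only [Prod.smul_fst, Prod.fst_add, Prod.fst_sum, smul_zero, Finset.sum_const_zero, add_zero,
      sub_smul]
    ext1 j
    simp [smul_eq_C_mul]
  · simp only [Prod.smul_snd, Prod.snd_add, Prod.snd_sum, smul_zero, zero_add]
    ext1 j
    simp [Finset.sum_apply, Pi.single_apply, smul_eq_C_mul]

/-- The coordinate module with `coordTau` satisfies the relation of the motive, so the universal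
property gives a map to it; both composites with `ofCoord` fix generators. -/
lemma exists_coord_equiv :
    ∃ e : Motive A 0 ≃ₗ[(CInf F)[X]] ((Fin n → (CInf F)[X]) × (Fin n → (CInf F)[X])),
      e.symm.toLinearMap = ofCoord A := by
  obtain ⟨φ, hφ, hg⟩ := exists_motive_hom (coordTau A) (X_smul_single A)
  have h1 : ofCoord A ∘ₗ φ = LinearMap.id := by
    refine motive_hom_ext (τ := motiveTau A 0) (fun m ↦ ?_) (fun m ↦ rfl) fun i ↦ ?_
    · rw [LinearMap.comp_apply, hφ, ofCoord_coordTau]; rfl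
    · rw [LinearMap.comp_apply, hg, ofCoord_apply]
      simp [Pi.single_apply]
  have h2 : φ ∘ₗ ofCoord A = LinearMap.id := by
    refine LinearMap.ext fun p ↦ ?_
    rw [LinearMap.comp_apply, ofCoord_apply, map_add, map_sum, map_sum]
    simp only [map_smul, hφ, hg, coordTau_single]
    ext1 <;> funext j <;> simp [Pi.single_apply, Prod.fst_sum, Prod.snd_sum, Finset.sum_apply]
  exact ⟨LinearEquiv.ofLinearMap φ (ofCoord A) h2 h1, rfl⟩

lemma exists_motive_basis : ∃ b : Module.Basis (Fin n ⊕ Fin n) (CInf F)[X] (Motive A 0),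
    (∀ i, b (.inl i) = gen A i) ∧ ∀ i, b (.inr i) = motiveTau A 0 (gen A i) := by
  obtain ⟨e, he⟩ := exists_coord_equiv A
  have he' (p) : e.symm p = ofCoord A p := LinearMap.congr_fun he p
  refine ⟨((Pi.basisFun _ (Fin n)).prod (Pi.basisFun _ (Fin n))).map e.symm, fun i ↦ ?_, fun i ↦ ?_⟩
  · simp [he', ofCoord_apply, Pi.single_apply]
  · simp [he', ofCoord_apply, Pi.single_apply]

end Basis

/-! ### The absolute value of `θ` -/

section Theta

variable (F : Type*) [Field F] [Fintype F]

lemma CInf.one_lt_norm_theta : 1 < ‖CInf.theta F‖ := by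
  classical
  have h1 : ‖CInf.theta F‖ = ‖algebraMap (KInf F) (KInfAlg F) (KInf.theta F)‖ :=
    UniformSpace.Completion.norm_coe (E := KInfAlg F) _
  have h2 : ‖algebraMap (KInf F) (KInfAlg F) (KInf.theta F)‖ = ‖KInf.theta F‖ :=
    spectralNorm_extends _
  rw [h1, h2]
  refine Valued.toNormedField.one_lt_norm_iff.2 ?_
  rw [KInf.valued_theta, ← WithZero.exp_zero, WithZero.exp_lt_exp]
  exact one_pos

end Theta

/-! ### Coefficients in `C∞{T}` -/

section Coefficients

variable {F : Type*} [Field F] [Fintype F]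

lemma coeff_X_pow_smul (k m : ℕ) (f : Tate F) :
    PowerSeries.coeff m ((X ^ k : (CInf F)[X]) • f).1 =
      if k ≤ m then PowerSeries.coeff (m - k) f.1 else 0 := by
  change PowerSeries.coeff m ((X ^ k : (CInf F)[X]) • f.1) = _
  rw [Algebra.smul_def, PowerSeries.algebraMap_apply']
  simp [PowerSeries.coeff_X_pow_mul']

lemma coeff_X_smul_zero (f : Tate F) : PowerSeries.coeff 0 ((X : (CInf F)[X]) • f).1 = 0 := by
  simpa using coeff_X_pow_smul 1 0 f

lemma coeff_X_smul_succ (m : ℕ) (f : Tate F) :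
    PowerSeries.coeff (m + 1) ((X : (CInf F)[X]) • f).1 = PowerSeries.coeff m f.1 := by
  simpa using coeff_X_pow_smul 1 (m + 1) f

lemma coeff_C_smul (c : CInf F) (m : ℕ) (f : Tate F) :
    PowerSeries.coeff m ((C c : (CInf F)[X]) • f).1 = c * PowerSeries.coeff m f.1 := by
  change PowerSeries.coeff m ((C c : (CInf F)[X]) • f.1) = _
  rw [Algebra.smul_def, PowerSeries.algebraMap_apply']
  simp

lemma coeff_smul (c : CInf F) (m : ℕ) (f : Tate F) :
    PowerSeries.coeff m (c • f).1 = c * PowerSeries.coeff m f.1 := by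
  rw [smul_eq_C_smul, coeff_C_smul]

lemma coeff_add (m : ℕ) (f g : Tate F) :
    PowerSeries.coeff m (f + g).1 = PowerSeries.coeff m f.1 + PowerSeries.coeff m g.1 :=
  map_add _ _ _

lemma coeff_sub (m : ℕ) (f g : Tate F) :
    PowerSeries.coeff m (f - g).1 = PowerSeries.coeff m f.1 - PowerSeries.coeff m g.1 :=
  map_sub _ _ _

lemma coeff_tateFrob (m : ℕ) (f : Tate F) :
    PowerSeries.coeff m (tateFrob F f).1 = PowerSeries.coeff m f.1 ^ Fintype.card F :=
  PowerSeries.coeff_map _ _ _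

lemma Tate.ext_coeff {f g : Tate F} (h : ∀ m, PowerSeries.coeff m f.1 = PowerSeries.coeff m g.1) :
    f = g :=
  Subtype.ext (PowerSeries.ext h)

end Coefficients

/-! ### The motive of the theorem, for `q = 2` -/

section Two

/-- The field `C∞` for `q = 2`. -/
local notation "K" => CInf (ZMod 2)

/-- The element `θ` for `q = 2`. -/
local notation "θ" => CInf.theta (ZMod 2)

lemma two_eq_zero : (2 : K) = 0 := by
  have h : (2 : ZMod 2) = 0 := rfl
  have h' := congrArg (algebraMap (ZMod 2) K) h
  rwa [map_ofNat, map_zero] at h'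

lemma theta_ne_zero : θ ≠ 0 := norm_pos_iff.1 (one_pos.trans (CInf.one_lt_norm_theta (ZMod 2)))

lemma coeff_tateFrob_two (m : ℕ) (f : Tate (ZMod 2)) :
    PowerSeries.coeff m (tateFrob (ZMod 2) f).1 = PowerSeries.coeff m f.1 ^ 2 := by
  rw [coeff_tateFrob, ZMod.card]

lemma entries_eq {A : Matrix (Fin 2) (Fin 2) K} (hA : A = !![θ, θ ^ 6; θ ^ (-2 : ℤ), 0]) :
    A 0 0 = θ ∧ A 0 1 = θ ^ 6 ∧ A 1 0 = θ⁻¹ ^ 2 ∧ A 1 1 = 0 := by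
  subst hA
  exact ⟨rfl, rfl, by rw [inv_pow]; exact zpow_neg θ 2, rfl⟩

/-- Comparison of coefficients of `T ^ m`; the factor `θ ^ 3` is the change of coordinates that
turns `θ ^ 6 * y ^ 2` into `w ^ 2`. -/
lemma isHomSeq_iff {A : Matrix (Fin 2) (Fin 2) K} (hA : A = !![θ, θ ^ 6; θ ^ (-2 : ℤ), 0])
    (f : Fin 2 → Tate (ZMod 2)) :
    (∀ i, (X : K[X]) • f i = θ • f i + ∑ j, A i j • tateFrob (ZMod 2) (f j) +
      tateFrob (ZMod 2) (tateFrob (ZMod 2) (f i))) ↔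
    IsHomSeq θ (fun m ↦ PowerSeries.coeff m (f 0).1)
      (fun m ↦ θ ^ 3 * PowerSeries.coeff m (f 1).1) := by
  have hθ := theta_ne_zero
  obtain ⟨hA00, hA01, hA10, hA11⟩ := entries_eq hA
  have hc0 (m : ℕ) : PowerSeries.coeff m (θ • f 0 + ∑ j, A 0 j • tateFrob (ZMod 2) (f j) +
      tateFrob (ZMod 2) (tateFrob (ZMod 2) (f 0))).1 =
      homFst θ (PowerSeries.coeff m (f 0).1) (θ ^ 3 * PowerSeries.coeff m (f 1).1) := by
    rw [Fin.sum_univ_two, coeff_add, coeff_add, coeff_add, coeff_smul, coeff_smul, coeff_smul,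
      coeff_tateFrob_two, coeff_tateFrob_two, coeff_tateFrob_two, coeff_tateFrob_two, hA00, hA01, homFst]
    ring
  have hc1 (m : ℕ) : θ ^ 3 * PowerSeries.coeff m (θ • f 1 +
      ∑ j, A 1 j • tateFrob (ZMod 2) (f j) + tateFrob (ZMod 2) (tateFrob (ZMod 2) (f 1))).1 =
      homSnd θ (PowerSeries.coeff m (f 0).1) (θ ^ 3 * PowerSeries.coeff m (f 1).1) := by
    rw [Fin.sum_univ_two, coeff_add, coeff_add, coeff_add, coeff_smul, coeff_smul, coeff_smul,
      coeff_tateFrob_two, coeff_tateFrob_two, coeff_tateFrob_two, coeff_tateFrob_two, hA10, hA11, homSnd]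
    have h1 : θ ^ 3 * θ⁻¹ ^ 2 = θ := by field_simp
    have h2 : θ⁻¹ ^ 9 * θ ^ 12 = θ ^ 3 := by field_simp
    linear_combination PowerSeries.coeff m (f 0).1 ^ 2 * h1 -
      PowerSeries.coeff m (f 1).1 ^ 4 * h2
  constructor
  · intro h
    refine ⟨?_, ?_, fun m ↦ ?_, fun m ↦ ?_⟩
    · rw [← hc0, ← h, coeff_X_smul_zero]
    · rw [← hc1, ← h, coeff_X_smul_zero, mul_zero]
    · rw [← hc0, ← h, coeff_X_smul_succ]
    · rw [← hc1, ← h, coeff_X_smul_succ]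
  · intro h
    refine Fin.forall_fin_two.2 ⟨Tate.ext_coeff fun m ↦ ?_, Tate.ext_coeff fun m ↦ ?_⟩
    · rw [hc0]
      cases m with
      | zero => rw [coeff_X_smul_zero]; exact h.fst_zero.symm
      | succ m => rw [coeff_X_smul_succ]; exact (h.fst_succ m).symm
    · apply mul_left_cancel₀ (pow_ne_zero 3 hθ)
      rw [hc1]
      cases m with
      | zero => rw [coeff_X_smul_zero, mul_zero]; exact h.snd_zero.symm
      | succ m => rw [coeff_X_smul_succ]; exact (h.snd_succ m).symm

variable {A : Matrix (Fin 2) (Fin 2) K}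

lemma isHomSeq_of_mem (hA : A = !![θ, θ ^ 6; θ ^ (-2 : ℤ), 0])
    (φ : HLower (motiveTau A 0)) :
    IsHomSeq θ (fun m ↦ PowerSeries.coeff m (φ.1 (gen A 0)).1)
      (fun m ↦ θ ^ 3 * PowerSeries.coeff m (φ.1 (gen A 1)).1) := by
  refine (isHomSeq_iff hA fun i ↦ φ.1 (gen A i)).1 fun i ↦ ?_
  have hφ : ∀ m, φ.1 (motiveTau A 0 m) = tateFrob (ZMod 2) (φ.1 m) := φ.2
  have h (c : K) (m : Motive A 0) : φ.1 (c • m) = c • φ.1 m := by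
    rw [smul_eq_C_smul, smul_eq_C_smul, map_smul]
  rw [← map_smul, X_smul_gen, map_add, map_add, map_sum, h, hφ, hφ]
  simp only [h, hφ]

lemma exists_generator (hA : A = !![θ, θ ^ 6; θ ^ (-2 : ℤ), 0]) :
    ∃ φ : HLower (motiveTau A 0),
      ‖1 + PowerSeries.coeff 0 (φ.1 (gen A 0)).1‖ < 1 ∧
      ‖1 + θ ^ 3 * PowerSeries.coeff 0 (φ.1 (gen A 1)).1‖ < 1 ∧
      ∀ m ≠ 0, ‖PowerSeries.coeff m (φ.1 (gen A 0)).1‖ < 1 ∧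
        ‖θ ^ 3 * PowerSeries.coeff m (φ.1 (gen A 1)).1‖ < 1 := by
  have ht := CInf.one_lt_norm_theta (ZMod 2)
  have hθ := theta_ne_zero
  obtain ⟨x, w, hs, hx, hw, hle⟩ := exists_isHomSeq ht two_eq_zero
  have hi : ‖θ‖⁻¹ < 1 := inv_lt_one_of_one_lt₀ ht
  have hi0 : 0 ≤ ‖θ‖⁻¹ := inv_nonneg.2 (norm_nonneg _)
  have hlim := tendsto_pow_atTop_nhds_zero_of_lt_one hi0 hi
  have hx0 : Filter.Tendsto x Filter.atTop (nhds 0) :=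
    squeeze_zero_norm (fun m ↦ (hle m).1) hlim
  have hw0 : Filter.Tendsto w Filter.atTop (nhds 0) :=
    squeeze_zero_norm (fun m ↦ (hle m).2) hlim
  have hw0' : Filter.Tendsto (fun m ↦ (θ ^ 3)⁻¹ * w m) Filter.atTop (nhds 0) := by
    simpa using hw0.const_mul (θ ^ 3)⁻¹
  let f : Fin 2 → Tate (ZMod 2) := ![⟨PowerSeries.mk x, by simpa [Tate] using hx0⟩,
    ⟨PowerSeries.mk fun m ↦ (θ ^ 3)⁻¹ * w m, by simpa [Tate] using hw0'⟩]
  have hf0 (m : ℕ) : PowerSeries.coeff m (f 0).1 = x m := PowerSeries.coeff_mk _ _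
  have hf1 (m : ℕ) : θ ^ 3 * PowerSeries.coeff m (f 1).1 = w m := by
    have : PowerSeries.coeff m (f 1).1 = (θ ^ 3)⁻¹ * w m :=
      PowerSeries.coeff_mk m fun m ↦ (θ ^ 3)⁻¹ * w m
    rw [this, mul_inv_cancel_left₀ (pow_ne_zero 3 hθ)]
  obtain ⟨φ, hφ, hg⟩ := exists_motive_hom (tateFrob (ZMod 2)) ((isHomSeq_iff hA f).2
    (by simpa only [hf0, hf1] using hs))
  refine ⟨⟨φ, hφ⟩, ?_⟩
  simp only [hg, hf0, hf1]
  exact ⟨hx, hw, fun m hm ↦ ⟨(hle m).1.trans_lt (pow_lt_one₀ hi0 hi hm),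
    (hle m).2.trans_lt (pow_lt_one₀ hi0 hi hm)⟩⟩

lemma coeff_pow_smul_HLower (k m : ℕ) (φ : HLower (motiveTau A 0)) (v : Motive A 0) :
    PowerSeries.coeff m (((X ^ k : (ZMod 2)[X]) • φ).1 v).1 =
      if k ≤ m then PowerSeries.coeff (m - k) (φ.1 v).1 else 0 := by
  have h : algebraMap (ZMod 2)[X] K[X] (X ^ k) = X ^ k := by
    change Polynomial.mapRingHom _ (X ^ k) = _
    simp
  change PowerSeries.coeff m (algebraMap (ZMod 2)[X] K[X] (X ^ k) • φ.1 v).1 = _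
  rw [h, coeff_X_pow_smul]

/-- The values lie in the domain `C∞[[T]]`. -/
lemma smul_HLower_eq_zero {φ : HLower (motiveTau A 0)} {v : Motive A 0} (h : φ.1 v ≠ 0)
    {p : (ZMod 2)[X]} (hp : p • φ = 0) : p = 0 := by
  have h1 : algebraMap (ZMod 2)[X] K[X] p • φ.1 v = 0 :=
    LinearMap.congr_fun (congrArg Subtype.val hp) v
  have h2 : algebraMap (ZMod 2)[X] K[X] p • (φ.1 v).1 = 0 := congrArg Subtype.val h1
  rw [Algebra.smul_def, mul_eq_zero, PowerSeries.algebraMap_apply'] at h2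
  have h3 := h2.resolve_right fun h3 ↦ h (Subtype.ext h3)
  rw [Algebra.algebraMap_self, PowerSeries.map_id, id_eq] at h3
  have h4 : p.map (algebraMap (ZMod 2) K) = 0 := by
    rwa [Polynomial.coe_eq_zero_iff] at h3
  exact (Polynomial.map_eq_zero _).1 h4

lemma add_smul_eq_of_smul_eq {N : Type*} [AddCommMonoid N] [Module (ZMod 2)[X] N] {x y : N}
    {p q : (ZMod 2)[X]} (h : p • x = y + q • x) : (p + q) • x = y := by
  have h2 : q + q = 0 := CharTwo.add_self_eq_zero q
  rw [add_smul, h, add_assoc, ← add_smul, h2, zero_smul, add_zero]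

/-- Induction on the index from which `ψ` has small coefficients: a last coefficient that is not
small is close to the constant coefficient of `φ`, and a shift of `φ` removes it. -/
lemma exists_smul_generator (hA : A = !![θ, θ ^ 6; θ ^ (-2 : ℤ), 0])
    {φ : HLower (motiveTau A 0)}
    (h0 : ‖1 + PowerSeries.coeff 0 (φ.1 (gen A 0)).1‖ < 1)
    (h1 : ‖1 + θ ^ 3 * PowerSeries.coeff 0 (φ.1 (gen A 1)).1‖ < 1)
    (hm : ∀ m ≠ 0, ‖PowerSeries.coeff m (φ.1 (gen A 0)).1‖ < 1 ∧
        ‖θ ^ 3 * PowerSeries.coeff m (φ.1 (gen A 1)).1‖ < 1)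
    (N : ℕ) (ψ : HLower (motiveTau A 0))
    (hψ : ∀ m, N ≤ m → ‖PowerSeries.coeff m (ψ.1 (gen A 0)).1‖ < 1 ∧
        ‖θ ^ 3 * PowerSeries.coeff m (ψ.1 (gen A 1)).1‖ < 1) :
    ∃ p : (ZMod 2)[X], p • φ = ψ := by
  have ht := CInf.one_lt_norm_theta (ZMod 2)
  have hθ := theta_ne_zero
  induction N generalizing ψ with
  | zero =>
    have hz := (isHomSeq_of_mem hA ψ).eq_zero ht fun m ↦ hψ m m.zero_le
    refine ⟨0, ?_⟩
    rw [zero_smul]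
    refine Subtype.ext (motive_hom_ext (τ := tateFrob (ZMod 2)) (fun m ↦ ?_) ψ.2
      (Fin.forall_fin_two.2 ⟨Tate.ext_coeff fun m ↦ ?_, Tate.ext_coeff fun m ↦ ?_⟩))
    · exact (map_zero (tateFrob (ZMod 2))).symm
    · exact (hz m).1.symm
    · exact ((mul_eq_zero.1 (hz m).2).resolve_left (pow_ne_zero 3 hθ)).symm
  | succ N ih =>
    have hφ := isHomSeq_of_mem hA φ
    rcases (isHomSeq_of_mem hA ψ).small_or_sub_small ht two_eq_zero (hψ (N + 1) le_rfl)
      hφ.fst_zero hφ.snd_zero h0 h1 with hN | hN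
    · refine ih ψ fun m hm ↦ ?_
      rcases hm.eq_or_lt with rfl | hm
      · exact hN
      · exact hψ m hm
    -- Adding is subtracting here. The coefficient `N` becomes small, and those above it stay small
    -- because `φ` has small coefficients beyond the constant one.
    · obtain ⟨p, hp⟩ : ∃ p : (ZMod 2)[X], p • φ = ψ + (X ^ N : (ZMod 2)[X]) • φ := by
        refine ih _ fun m hNm ↦ ?_
        have hc (v : Motive A 0) : PowerSeries.coeff m
            ((ψ + (X ^ N : (ZMod 2)[X]) • φ).1 v).1 =
            PowerSeries.coeff m (ψ.1 v).1 + PowerSeries.coeff (m - N) (φ.1 v).1 := by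
          change PowerSeries.coeff m (ψ.1 v + ((X ^ N : (ZMod 2)[X]) • φ).1 v).1 = _
          rw [coeff_add, coeff_pow_smul_HLower, if_pos hNm]
        rw [hc, hc, mul_add]
        rcases hNm.eq_or_lt with rfl | hNm
        · have hsub (x y : K) : x - y = x + y := by linear_combination (-y) * two_eq_zero
          rw [hsub, hsub] at hN
          rw [Nat.sub_self]
          exact hN
        · have ha := hψ m hNm
          have hb := hm (m - N) (by omega)
          exact ⟨norm_add_lt_of_lt ha.1 hb.1, norm_add_lt_of_lt ha.2 hb.2⟩
      exact ⟨p + X ^ N, add_smul_eq_of_smul_eq hp⟩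

/-- `H₁(M)` is generated by one element without torsion. -/
lemma nonempty_equiv_HLower (hA : A = !![θ, θ ^ 6; θ ^ (-2 : ℤ), 0]) :
    Nonempty ((ZMod 2)[X] ≃ₗ[(ZMod 2)[X]] HLower (motiveTau A 0)) := by
  obtain ⟨φ, h0, h1, hm⟩ := exists_generator hA
  refine ⟨LinearEquiv.ofBijective (LinearMap.toSpanSingleton (ZMod 2)[X] _ φ) ⟨?_, fun ψ ↦ ?_⟩⟩
  · refine (injective_iff_map_eq_zero _).2 fun p hp ↦ ?_
    refine smul_HLower_eq_zero (v := gen A 0) (fun h ↦ ?_) hp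
    -- A zero value would give `‖1 + 0‖ < 1`.
    rw [h] at h0
    simp at h0
  · have hx : Filter.Tendsto (fun m ↦ PowerSeries.coeff m (ψ.1 (gen A 0)).1) Filter.atTop
        (nhds 0) := (ψ.1 (gen A 0)).2
    have hw : Filter.Tendsto (fun m ↦ θ ^ 3 * PowerSeries.coeff m (ψ.1 (gen A 1)).1)
        Filter.atTop (nhds 0) := by
      have h : Filter.Tendsto (fun m ↦ PowerSeries.coeff m (ψ.1 (gen A 1)).1) Filter.atTop
        (nhds 0) := (ψ.1 (gen A 1)).2
      simpa using h.const_mul (θ ^ 3)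
    obtain ⟨N, hN⟩ := Filter.eventually_atTop.1
      ((hx.norm.eventually_lt_const (by rw [norm_zero]; exact one_pos)).and
        (hw.norm.eventually_lt_const (by rw [norm_zero]; exact one_pos)))
    exact exists_smul_generator hA h0 h1 hm N ψ hN

lemma tensorTau_tmul {F M : Type*} [Field F] [Fintype F] [AddCommGroup M] [Module (CInf F)[X] M]
    (τ : M →ₛₗ[polyFrob F] M) (m : M) (f : Tate F) :
    tensorTau τ (m ⊗ₜ f) = τ m ⊗ₜ tateFrob F f := rfl

lemma sum_add_sum_sub_comm {ι G : Type*} [Fintype ι] [AddCommGroup G] (p q : ι → G)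
    (r : ι → ι → G) :
    ∑ i, p i + ∑ j, (q j - ∑ i, r i j) = ∑ i, q i + ∑ i, (p i - ∑ j, r i j) := by
  rw [Finset.sum_sub_distrib, Finset.sum_sub_distrib, Finset.sum_comm (f := r)]
  abel

/-- Both sides of `τ y = y` are compared in the basis `eᵢ, τ eᵢ`, with `τ² eᵢ` rewritten by
`tau_tau_gen`. -/
lemma coord_of_fixed {F : Type*} [Field F] [Fintype F] {n : ℕ} {A : Matrix (Fin n) (Fin n) (CInf F)}
    {y : Motive A 0 ⊗[(CInf F)[X]] Tate F} (hy : tensorTau (motiveTau A 0) y = y) :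
    ∃ a b : Fin n → Tate F,
      y = ∑ i, gen A i ⊗ₜ a i + ∑ i, motiveTau A 0 (gen A i) ⊗ₜ b i ∧
      (∀ i, a i = (X - C (CInf.theta F)) • tateFrob F (b i)) ∧
      ∀ j, b j = tateFrob F (a j) - ∑ i, C (A i j) • tateFrob F (b i) := by
  classical
  obtain ⟨B, hB1, hB2⟩ := exists_motive_basis A
  let e := TensorProduct.equivFinsuppOfBasisLeft (N := Tate F) B
  have hsum (c : Fin n ⊕ Fin n →₀ Tate F) : e.symm c =
      ∑ i, gen A i ⊗ₜ c (.inl i) + ∑ i, motiveTau A 0 (gen A i) ⊗ₜ c (.inr i) := by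
    rw [TensorProduct.equivFinsuppOfBasisLeft_symm_apply,
      Finsupp.sum_fintype _ _ fun i ↦ TensorProduct.tmul_zero _ _, Fintype.sum_sum_type]
    simp only [hB1, hB2]
  obtain ⟨c, rfl⟩ := e.symm.surjective y
  refine ⟨fun i ↦ c (.inl i), fun i ↦ c (.inr i), hsum c, ?_⟩
  let c' : Fin n ⊕ Fin n →₀ Tate F := Finsupp.equivFunOnFinite.symm
    (Sum.elim (fun i ↦ (X - C (CInf.theta F)) • tateFrob F (c (.inr i)))
      fun j ↦ tateFrob F (c (.inl j)) - ∑ i, C (A i j) • tateFrob F (c (.inr i)))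
  have hc' : c' = c := by
    apply e.symm.injective
    rw [← hy, hsum, hsum, map_add, map_sum, map_sum]
    simp only [tensorTau_tmul, tau_tau_gen, TensorProduct.sub_tmul, TensorProduct.sum_tmul,
      TensorProduct.smul_tmul, c', Finsupp.equivFunOnFinite_symm_apply_apply,
      Sum.elim_inl, Sum.elim_inr, TensorProduct.tmul_sub, TensorProduct.tmul_sum]
    exact sum_add_sum_sub_comm (G := Motive A 0 ⊗[(CInf F)[X]] Tate F) _ _ _
  exact ⟨fun i ↦ (DFunLike.congr_fun hc' (.inl i)).symm,
    fun j ↦ (DFunLike.congr_fun hc' (.inr j)).symm⟩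

/-- There is no nonzero `τ`-invariant. -/
lemma eq_zero_of_fixed (hA : A = !![θ, θ ^ 6; θ ^ (-2 : ℤ), 0])
    {y : Motive A 0 ⊗[K[X]] Tate (ZMod 2)} (hy : tensorTau (motiveTau A 0) y = y) : y = 0 := by
  have ht := CInf.one_lt_norm_theta (ZMod 2)
  have hθ := theta_ne_zero
  have h2 := two_eq_zero
  obtain ⟨a, b, rfl, ha, hb⟩ := coord_of_fixed hy
  have ha0 (i : Fin 2) : PowerSeries.coeff 0 (a i).1 = -(θ * PowerSeries.coeff 0 (b i).1 ^ 2) := by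
    rw [ha, sub_smul, coeff_sub, coeff_X_smul_zero, coeff_C_smul, coeff_tateFrob_two, zero_sub]
  have ha1 (i : Fin 2) (m : ℕ) : PowerSeries.coeff (m + 1) (a i).1 =
      PowerSeries.coeff m (b i).1 ^ 2 - θ * PowerSeries.coeff (m + 1) (b i).1 ^ 2 := by
    rw [ha, sub_smul, coeff_sub, coeff_X_smul_succ, coeff_C_smul, coeff_tateFrob_two,
      coeff_tateFrob_two]
  have hb' (j : Fin 2) (m : ℕ) : PowerSeries.coeff m (b j).1 = PowerSeries.coeff m (a j).1 ^ 2 -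
      (A 0 j * PowerSeries.coeff m (b 0).1 ^ 2 + A 1 j * PowerSeries.coeff m (b 1).1 ^ 2) := by
    conv_lhs => rw [hb j]
    rw [coeff_sub, coeff_tateFrob_two, Fin.sum_univ_two, coeff_add, coeff_C_smul, coeff_C_smul,
      coeff_tateFrob_two, coeff_tateFrob_two]
  obtain ⟨hA00, hA01, hA10, hA11⟩ := entries_eq hA
  have hq : θ ^ 8 * θ⁻¹ ^ 2 = θ ^ 6 := by field_simp
  -- Eliminating `a` gives `bⱼ,ₘ₋₁⁴ = bⱼ,ₘ + θ² bⱼ,ₘ⁴ + ∑ᵢ Aᵢⱼ bᵢ,ₘ²`, with left side `0` for `m =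
  -- 0`. The scaling `u = θ² b₀` gives `u` and `v²` the common factor `θ⁶`.
  have hseq : IsCohSeq θ (fun m ↦ θ ^ 2 * PowerSeries.coeff m (b 0).1)
      (fun m ↦ PowerSeries.coeff m (b 1).1) := by
    refine ⟨?_, ?_, fun m ↦ ?_, fun m ↦ ?_⟩
    · have e := hb' 0 0
      rw [ha0, hA00, hA10] at e
      rw [cohFst]
      linear_combination θ ^ 8 * e - PowerSeries.coeff 0 (b 1).1 ^ 2 * hq +
        θ ^ 10 * PowerSeries.coeff 0 (b 0).1 ^ 4 * h2
    · have e := hb' 1 0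
      rw [ha0, hA01, hA11] at e
      rw [cohSnd]
      linear_combination e + (θ ^ 2 * PowerSeries.coeff 0 (b 1).1 ^ 4 +
        θ ^ 4 * PowerSeries.coeff 0 (b 0).1 * PowerSeries.coeff 0 (b 1).1 ^ 2) * h2
    · have e := hb' 0 (m + 1)
      rw [ha1, hA00, hA10] at e
      rw [cohFst]
      linear_combination (-θ ^ 8) * e + PowerSeries.coeff (m + 1) (b 1).1 ^ 2 * hq +
        (θ ^ 9 * PowerSeries.coeff m (b 0).1 ^ 2 * PowerSeries.coeff (m + 1) (b 0).1 ^ 2 -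
          θ ^ 10 * PowerSeries.coeff (m + 1) (b 0).1 ^ 4) * h2
    · have e := hb' 1 (m + 1)
      rw [ha1, hA01, hA11] at e
      rw [cohSnd]
      linear_combination (-1) * e + (θ * PowerSeries.coeff m (b 1).1 ^ 2 *
        PowerSeries.coeff (m + 1) (b 1).1 ^ 2 - θ ^ 2 * PowerSeries.coeff (m + 1) (b 1).1 ^ 4 -
        θ ^ 4 * PowerSeries.coeff (m + 1) (b 0).1 * PowerSeries.coeff (m + 1) (b 1).1 ^ 2) * h2
  have hlim (i : Fin 2) : Filter.Tendsto (fun m ↦ PowerSeries.coeff m (b i).1) Filter.atTop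
      (nhds 0) := (b i).2
  have hz := hseq.eq_zero ht (by simpa using (hlim 0).const_mul (θ ^ 2)) (hlim 1)
  have hb0 : ∀ i, b i = 0 := Fin.forall_fin_two.2
    ⟨Tate.ext_coeff fun m ↦ (mul_eq_zero.1 (hz m).1).resolve_left (pow_ne_zero 2 hθ),
      Tate.ext_coeff fun m ↦ (hz m).2⟩
  have ha0 (i : Fin 2) : a i = 0 := by rw [ha, hb0, map_zero, smul_zero]
  simp [hb0, ha0]

end Two

end AndersonMotive

end

theorem theorem4p1
    (A : Matrix (Fin 2) (Fin 2) (AndersonMotive.CInf (ZMod 2)))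
    (hA : A = !![AndersonMotive.CInf.theta (ZMod 2), AndersonMotive.CInf.theta (ZMod 2) ^ 6;
                 AndersonMotive.CInf.theta (ZMod 2) ^ (-2 : ℤ), 0]) :
    AndersonMotive.hUpper (AndersonMotive.motiveTau A 0) = 0 ∧
    (∀ y, AndersonMotive.tensorTau (AndersonMotive.motiveTau A 0) y = y → y = 0) ∧
    Module.Free (Polynomial (ZMod 2)) (AndersonMotive.HLower (AndersonMotive.motiveTau A 0)) ∧
    AndersonMotive.hLower (AndersonMotive.motiveTau A 0) = 1 := by
  obtain ⟨e⟩ := AndersonMotive.nonempty_equiv_HLower hA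
  refine ⟨?_, fun y ↦ AndersonMotive.eq_zero_of_fixed hA, Module.Free.of_equiv e, ?_⟩
  · have : Subsingleton (AndersonMotive.HUpper (AndersonMotive.motiveTau A 0)) :=
      ⟨fun y z ↦ Subtype.ext ((AndersonMotive.eq_zero_of_fixed hA y.2).trans
        (AndersonMotive.eq_zero_of_fixed hA z.2).symm)⟩
    exact rank_subsingleton' _ _
  · exact e.rank_eq.symm.trans (Module.rank_self _)
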